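/- Let $M$ be a connected (Hausdorff, second countable) smooth manifold of dimension $n$ without boundary, $\nabla$ a smooth torsion-free linear connection on $M$, and $\hbar\neq 0$ a real constant. All functions, tensors and vector fields below are smooth and complex-valued (i.e. tensors are sections of the complexified tensor bundles). Write $C^\infty(M)$ for the $\mathbb C$-algebra of smooth complex functions and $\mathfrak m_x\subset C^\infty(M)$ for the ideal of functions vanishing at $x$. Definitions. A linear differential operator is a $\mathbb C$-linear map $P\colon C^\infty(M)\to C^\infty(M)$ for which there is an integer $r\ge 0$ with $P(\mathfrak m_x^{r+1})\subset\mathfrak m_x$ for all $x\in M$. For a symmetric contravariant tensor field $\Phi=\Phi_r+\dots+\Phi_0$ ($\Phi_k$ homogeneous of order $k$), its quantized operator is $$\widehat\Phi(f)=\sum_k(-i\hbar)^k\langle\Phi_k,\nabla^k_{\rm sym}f\rangle ,$$ where $\nabla^k_{\rm sym}f$ is the symmetrization of the $k$-th iterated covariant differential of $f$; one says that $\Phi$ is the dequantized tensor of $P$ if $P=\widehat\Phi$. The function on $T^*M$ associated with $\Phi$ is $F_\Phi(\alpha_x)=\sum_k\langle\Phi_k,\alpha_x\otimes\cdots\otimes\alpha_x\rangle$.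 A Hamiltonian is a smooth function $F\colon T^*M\to\mathbb C$ that is polynomial along the fibres, of degree bounded by some $N$ independent of the fibre. Let $\theta$ be the Liouville $1$-form on $T^*M$ and $\omega_2=d\theta$ (locally $dp_j\wedge dx^j$); the Hamiltonian field of a smooth function $F$ is the vector field $D$ on $T^*M$ with $D\,\lrcorner\,\omega_2+dF=0$. Theorem. 1. For every symmetric contravariant tensor field $\Phi$, $\widehat\Phi$ is a linear differential operator, and every linear differential operator has exactly one dequantized tensor. 2. For every such $\Phi$, $F_\Phi$ is a Hamiltonian, and every Hamiltonian is $F_\Phi$ for exactly one $\Phi$. 3. Every smooth $F\colon T^*M\to\mathbb C$ has exactly one Hamiltonian field. 4. The map that sends a linear differential operator $P$ to its dequantized tensor $\Phi$, then to the function $F_\Phi$, and then to the Hamiltonian field of $F_\Phi$, induces a well-defined bijection from the set of linear differential operators modulo additive constants ($P\sim P+c$, $c\in\mathbb C$) onto the set of vector fields on $T^*M$ that are the Hamiltonian field of some Hamiltonian. -/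

import Mathlib

open Bundle Manifold
open scoped ContDiff

noncomputable section

namespace Dequantization

/-- The model vector space `ℝⁿ`. -/
abbrev RSpace (n : ℕ) : Type := EuclideanSpace ℝ (Fin n)

section Functions

/-- The smooth complex-valued functions on a manifold, as a subalgebra of all functions. -/
def smoothSubalgebra (n : ℕ) (M : Type*) [TopologicalSpace M] [ChartedSpace (RSpace n) M] :
    Subalgebra ℂ (M → ℂ) where
  carrier := {f | ContMDiff (𝓡 n) 𝓘(ℝ, ℂ) ∞ f}
  mul_mem' := fun hf hg =>
    ((contDiff_mul (𝕜 := ℝ) (𝔸 := ℂ)).contMDiff.comp (hf.prodMk_space hg) :)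
  add_mem' := fun hf hg => ContMDiff.add hf hg
  algebraMap_mem' := fun _ => contMDiff_const

/-- The `ℂ`-algebra `C^∞(M)` of smooth complex-valued functions on a manifold. -/
def SmoothFun (n : ℕ) (M : Type*) [TopologicalSpace M] [ChartedSpace (RSpace n) M] : Type _ :=
  ↥(smoothSubalgebra n M)

variable {n : ℕ} {M : Type*} [TopologicalSpace M] [ChartedSpace (RSpace n) M]

instance : CommRing (SmoothFun n M) := inferInstanceAs (CommRing ↥(smoothSubalgebra n M))

instance : Algebra ℂ (SmoothFun n M) := inferInstanceAs (Algebra ℂ ↥(smoothSubalgebra n M))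

instance : CoeFun (SmoothFun n M) (fun _ => M → ℂ) := ⟨fun f => f.1⟩

/-- The ideal `𝔪_x` of the smooth functions that vanish at `x`. -/
def vanishingIdeal (x : M) : Ideal (SmoothFun n M) where
  carrier := {f | f x = 0}
  zero_mem' := rfl
  add_mem' := fun {f g} (hf : f x = 0) (hg : g x = 0) =>
    show f x + g x = 0 by rw [hf, hg, add_zero]
  smul_mem' := fun g f (hf : f x = 0) => show g x * f x = 0 by rw [hf, mul_zero]

/-- `P` is a linear differential operator of order (at most) `r`: it maps `𝔪_x ^ (r + 1)`
into `𝔪_x` for every point `x`. -/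
def IsDiffOpOfOrder (r : ℕ) (P : Module.End ℂ (SmoothFun n M)) : Prop :=
  ∀ x : M, ∀ f ∈ (vanishingIdeal x : Ideal (SmoothFun n M)) ^ (r + 1),
    P f ∈ (vanishingIdeal x : Ideal (SmoothFun n M))

variable (n M) in
/-- The linear differential operators (of any finite order) on `C^∞(M)`. -/
abbrev DiffOp : Type _ :=
  {P : Module.End ℂ (SmoothFun n M) // ∃ r, IsDiffOpOfOrder r P}

variable (n M) in
/-- Two differential operators agree up to an additive constant: `P = Q + c` for a number `c ∈ ℂ`
(acting by multiplication). -/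
def eqUpToConst : Setoid (DiffOp n M) where
  r P Q := ∃ c : ℂ, ∀ (f : SmoothFun n M) (x : M), P.1 f x = Q.1 f x + c * f x
  iseqv :=
    { refl := fun P => ⟨0, fun f x => by ring⟩
      symm := by
        rintro P Q ⟨c, h⟩
        exact ⟨-c, fun f x => by rw [h]; ring⟩
      trans := by
        rintro P Q R ⟨c, h⟩ ⟨d, k⟩
        exact ⟨d + c, fun f x => by rw [h, k]; ring⟩ }

end Functions

section Tensors

variable {n : ℕ} {M : Type*} [TopologicalSpace M] [ChartedSpace (RSpace n) M]

variable (n) in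
/-- The cotangent space `T*_x M`. -/
abbrev CotSpace (x : M) : Type := TangentSpace (𝓡 n) x →L[ℝ] ℝ

variable (n M) in
/-- The cotangent bundle `T*M`. -/
abbrev CotBundle : Type _ := TotalSpace (RSpace n →L[ℝ] ℝ) (fun x : M => CotSpace n x)

variable (n) in
/-- The model with corners of the manifold `T*M`. -/
abbrev cotModel := (𝓡 n).prod 𝓘(ℝ, RSpace n →L[ℝ] ℝ)

/-- Smoothness of a real 1-form on `M`. -/
def IsSmoothForm [IsManifold (𝓡 n) ∞ M] (a : Π x : M, CotSpace n x) : Prop :=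
  ContMDiff (𝓡 n) (cotModel n) ∞ (fun x => (⟨x, a x⟩ : CotBundle n M))

variable (n M) in
/-- The (complex) smooth symmetric contravariant tensor fields of order `r` on `M`. At `x`, such a
tensor is a symmetric `ℝ`-multilinear form on `T*_x M` with values in `ℂ`, that is, an element
of `S^r (T_x M) ⊗ ℂ`; smoothness means that the contraction with smooth 1-forms is smooth. -/
def symTensors [IsManifold (𝓡 n) ∞ M] (r : ℕ) :
    Submodule ℂ (Π x : M, MultilinearMap ℝ (fun _ : Fin r => CotSpace n x) ℂ) where
  carrier := {Φ |
    (∀ x (σ : Equiv.Perm (Fin r)) (a : Fin r → CotSpace n x),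
      Φ x (fun i => a (σ i)) = Φ x a) ∧
    ∀ a : Fin r → Π x : M, CotSpace n x, (∀ i, IsSmoothForm (a i)) →
      ContMDiff (𝓡 n) 𝓘(ℝ, ℂ) ∞ (fun x => Φ x (fun i => a i x))}
  zero_mem' := ⟨fun _ _ _ => rfl, fun _ _ => contMDiff_const⟩
  add_mem' := by
    rintro Φ Ψ ⟨h1, h2⟩ ⟨h3, h4⟩
    exact ⟨fun x σ a => congrArg₂ (· + ·) (h1 x σ a) (h3 x σ a),
      fun a ha => (h2 a ha).add (h4 a ha)⟩
  smul_mem' := by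
    rintro c Φ ⟨h1, h2⟩
    exact ⟨fun x σ a => congrArg (c • ·) (h1 x σ a),
      fun a ha => ((contDiff_const_smul (𝕜 := ℝ) c).contMDiff.comp (h2 a ha) :)⟩

variable (n M) in
/-- Smooth symmetric contravariant tensor fields, not necessarily homogeneous:
finite sums `Φ_r + ⋯ + Φ_0` of homogeneous ones. -/
abbrev SymTensorField [IsManifold (𝓡 n) ∞ M] : Type _ := Π₀ r : ℕ, symTensors n M r

/-- The `j`-th coordinate vector of `T_x M` in the preferred chart at `x`. -/
def coordVec (x : M) (j : Fin n) : TangentSpace (𝓡 n) x :=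
  (EuclideanSpace.single j (1 : ℝ) : RSpace n)

/-- The `j`-th coordinate covector of `T*_x M` in the preferred chart at `x`; these form the
basis dual to `coordVec x`. -/
def coordCovec (x : M) (j : Fin n) : CotSpace n x :=
  (EuclideanSpace.proj j : RSpace n →L[ℝ] ℝ)

/-- Contraction of a contravariant and a covariant tensor of order `r` at the point `x`. -/
def contract {r : ℕ} (x : M) (Φ : MultilinearMap ℝ (fun _ : Fin r => CotSpace n x) ℂ)
    (t : (Fin r → TangentSpace (𝓡 n) x) → ℂ) : ℂ :=
  ∑ j : Fin r → Fin n, Φ (fun i => coordCovec x (j i)) * t (fun i => coordVec x (j i))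

end Tensors

section Quantization

variable {n : ℕ} {M : Type*} [TopologicalSpace M] [ChartedSpace (RSpace n) M]
  [IsManifold (𝓡 n) ∞ M]

/-- The covariant differential `∇t` of a covariant tensor field `t` of order `k` (given through
its values on tuples of tangent vectors):
`(∇t)(v₀, v₁, …, v_k) = v₀(t(V₁, …, V_k)) - ∑ i, t(V₁, …, ∇_{v₀} V_i, …, V_k)`,
where the local vector field `V_i` extends `v_i`. -/
def covDiff (nabla : CovariantDerivative (𝓡 n) (RSpace n) (TangentSpace (𝓡 n) : M → Type _))
    {k : ℕ} (t : Π x : M, (Fin k → TangentSpace (𝓡 n) x) → ℂ) (x : M)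
    (v : Fin (k + 1) → TangentSpace (𝓡 n) x) : ℂ :=
  mvfderiv (𝓡 n) (fun y => t y (fun i => FiberBundle.extend (RSpace n) (v i.succ) y)) x (v 0)
    - ∑ i : Fin k, t x (Function.update (fun j => v j.succ) i
        (nabla (FiberBundle.extend (RSpace n) (v i.succ)) x (v 0)))

/-- The iterated covariant differential `∇^r f` of a function `f`. -/
def iterCovDiff
    (nabla : CovariantDerivative (𝓡 n) (RSpace n) (TangentSpace (𝓡 n) : M → Type _))
    (f : M → ℂ) : (r : ℕ) → Π x : M, (Fin r → TangentSpace (𝓡 n) x) → ℂ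
  | 0 => fun x _ => f x
  | r + 1 => covDiff nabla (iterCovDiff nabla f r)

/-- The symmetrized iterated covariant differential `∇^r_sym f`. -/
def symCovDiff
    (nabla : CovariantDerivative (𝓡 n) (RSpace n) (TangentSpace (𝓡 n) : M → Type _))
    (f : M → ℂ) (r : ℕ) (x : M) (v : Fin r → TangentSpace (𝓡 n) x) : ℂ :=
  (r.factorial : ℂ)⁻¹ * ∑ σ : Equiv.Perm (Fin r), iterCovDiff nabla f r x (fun i => v (σ i))

open Classical in
/-- The quantized of `Φ = ∑ Φ_r`, applied to `f`, at `x`: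
`∑_r (-iℏ)^r ⟨Φ_r, ∇^r_sym f⟩`. -/
def quantize
    (nabla : CovariantDerivative (𝓡 n) (RSpace n) (TangentSpace (𝓡 n) : M → Type _))
    (hbar : ℝ) (Φ : SymTensorField n M) (f : M → ℂ) (x : M) : ℂ :=
  ∑ r ∈ Φ.support, (-Complex.I * hbar) ^ r *
    contract x ((Φ r : Π x : M, MultilinearMap ℝ (fun _ : Fin r => CotSpace n x) ℂ) x)
      (symCovDiff nabla f r x)

/-- `P` is the quantized of `Φ`; equivalently, `Φ` is a dequantized of `P`. -/
def IsQuantized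
    (nabla : CovariantDerivative (𝓡 n) (RSpace n) (TangentSpace (𝓡 n) : M → Type _))
    (hbar : ℝ) (Φ : SymTensorField n M) (P : Module.End ℂ (SmoothFun n M)) : Prop :=
  ∀ (f : SmoothFun n M) (x : M), P f x = quantize nabla hbar Φ f x

end Quantization

section Cotangent

variable {n : ℕ} {M : Type*} [TopologicalSpace M] [ChartedSpace (RSpace n) M]
  [IsManifold (𝓡 n) ∞ M]

open Classical in
/-- The function on `T*M` given by a symmetric contravariant tensor field:
`F(α_x) = ∑_r ⟨Φ_r, α_x ⊗ ⋯ ⊗ α_x⟩`. -/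
def hamiltonianOf (Φ : SymTensorField n M) (z : CotBundle n M) : ℂ :=
  ∑ r ∈ Φ.support,
    (Φ r : Π x : M, MultilinearMap ℝ (fun _ : Fin r => CotSpace n x) ℂ) z.1 (fun _ => z.2)

/-- A Hamiltonian: a smooth complex function on `T*M` whose restriction to every fibre is
a polynomial function, of degree bounded independently of the fibre. -/
def IsPolyHamiltonian (F : CotBundle n M → ℂ) : Prop :=
  ContMDiff (cotModel n) 𝓘(ℝ, ℂ) ∞ F ∧
  ∃ N : ℕ, ∀ x : M,
    ∃ Q : Π k : ℕ, MultilinearMap ℝ (fun _ : Fin k => CotSpace n x) ℂ,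
      ∀ α : CotSpace n x, F ⟨x, α⟩ = ∑ k ∈ Finset.range (N + 1), Q k (fun _ => α)

/-- The Liouville 1-form on `T*M`: `θ_α(w) = α(π_* w)`. -/
def liouville (z : CotBundle n M) : TangentSpace (cotModel n) z →L[ℝ] ℝ :=
  z.2.comp (mfderiv (cotModel n) (𝓡 n) (TotalSpace.proj : CotBundle n M → M) z)

/-- The Liouville form read in the preferred chart of `T*M` at `z`, as a 1-form on the model
vector space. -/
def liouvilleInChart (z : CotBundle n M) (y : RSpace n × (RSpace n →L[ℝ] ℝ)) :
    (RSpace n × (RSpace n →L[ℝ] ℝ)) →L[ℝ] ℝ :=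
  (liouville ((extChartAt (cotModel n) z).symm y)).comp
    (mfderiv 𝓘(ℝ, RSpace n × (RSpace n →L[ℝ] ℝ)) (cotModel n)
      (extChartAt (cotModel n) z).symm y)

/-- The symplectic form `ω₂ = dθ` on `T*M`, the exterior derivative being computed in a chart:
`dη(u, v) = (D_u η)(v) - (D_v η)(u)`. In local coordinates, `ω₂ = dp_j ∧ dx^j`. -/
def symplecticForm (z : CotBundle n M) (u v : TangentSpace (cotModel n) z) : ℝ :=
  let D := fderiv ℝ (liouvilleInChart z) (extChartAt (cotModel n) z z)
  let κ := mfderiv (cotModel n) 𝓘(ℝ, RSpace n × (RSpace n →L[ℝ] ℝ))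
    (extChartAt (cotModel n) z) z
  D (κ u) (κ v) - D (κ v) (κ u)

variable (n M) in
/-- A smooth complex tangent vector field `re + i im` on `T*M`. -/
@[ext]
structure ComplexField where
  re : Π z : CotBundle n M, TangentSpace (cotModel n) z
  im : Π z : CotBundle n M, TangentSpace (cotModel n) z
  smooth_re : ContMDiff (cotModel n) (cotModel n).tangent ∞
    (fun z => (⟨z, re z⟩ : TangentBundle (cotModel n) (CotBundle n M)))
  smooth_im : ContMDiff (cotModel n) (cotModel n).tangent ∞
    (fun z => (⟨z, im z⟩ : TangentBundle (cotModel n) (CotBundle n M)))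

/-- `D` is the Hamiltonian field (infinitesimal canonical transformation) of the function `F`:
`D ⌟ ω₂ + dF = 0`. -/
def IsHamiltonianField (F : CotBundle n M → ℂ) (D : ComplexField n M) : Prop :=
  ∀ (z : CotBundle n M) (v : TangentSpace (cotModel n) z),
    ((symplecticForm z (D.re z) v : ℂ) + Complex.I * (symplecticForm z (D.im z) v : ℂ))
      + mvfderiv (cotModel n) F z v = 0

variable (n M) in
/-- The infinitesimal canonical transformations of `T*M` that correspond to Hamiltonians
polynomial along the fibres. -/
abbrev PolyHamiltonianField : Type _ :=
  {D : ComplexField n M // ∃ F : CotBundle n M → ℂ, IsPolyHamiltonian F ∧ IsHamiltonianField F D}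

end Cotangent

end Dequantization

end

/-! The operator side rests on the filtration of `C^∞(M)` by the powers of `𝔪_x`. Each covariant
differentiation loses at most one power, so `∇^k f` vanishes at `x` when `f ∈ 𝔪_x ^ (k + 1)`. For `f
∈ 𝔪_x`, the only part of `∇^s (f ^ s)` that survives at `x` is the one where every derivative lowers
the exponent, namely `s! (df)^{⊗ s}`. Hence a tensor field of order at most `s` acts on `f ^ s` at
`x` through its top component alone, up to the nonzero factor `(-iℏ)^s s!` (`quantize_pow`).
Polarization then makes quantization injective (`eq_zero_of_quantize_eq_zero`).

Conversely, let `P` have order `s`. By Hadamard's lemma an element of `𝔪_x` is determined modulo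
`𝔪_x ^ 2` by its differential, so the value at `x` of `P` on a product of `s` elements of `𝔪_x`
depends only on their differentials. This defines the principal symbol, a smooth symmetric tensor
(`symbol`). After subtracting the quantization of the rescaled symbol, the remainder kills at `x`
all `f ^ s` with `f ∈ 𝔪_x`, hence by polarization all of `𝔪_x ^ s`. The order has dropped, and
induction gives `exists_isQuantized`.

On the cotangent side, the homogeneous parts of a fibrewise polynomial are fixed linear combinations
of its dilations by `0, …, N`, and polarization turns each part into a symmetric multilinear form.
Being finite combinations of values of `F`, these forms vary smoothly with the point
(`exists_hamiltonianOf_eq`).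

In the charts of `T*M` induced from `M` the Liouville form is `p dx`, so `ω₂` is the standard
nondegenerate form, and every smooth function has one smooth Hamiltonian field. Since `M` is
connected, two functions have the same field exactly when they differ by a constant. Adding a
constant to an operator adds that constant to the order-zero component of its tensor and so to its
Hamiltonian; the two equivalence relations therefore match (`eqUpToConst_iff`). -/

noncomputable section

namespace Dequantization

/-! ### Polarization of multilinear maps -/

section Polarization

/-- The polarization identity for multilinear maps. -/
theorem sum_powerset_neg_one_pow_smul_diagonal {R V W : Type*} [CommRing R] [AddCommGroup V]
    [AddCommGroup W] [Module R V] [Module R W] {k : ℕ}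
    (f : MultilinearMap R (fun _ : Fin k => V) W) (a : Fin k → V) :
    ∑ S : Finset (Fin k), (-1 : ℤ) ^ (Sᶜ).card • f (fun _ => ∑ i ∈ S, a i) =
      ∑ σ : Equiv.Perm (Fin k), f (fun i => a (σ i)) := by
  classical
  have hind (S : Finset (Fin k)) : f (fun _ => ∑ i ∈ S, a i) =
      ∑ J : Fin k → Fin k, if (∀ i, J i ∈ S) then f (fun i => a (J i)) else 0 := by
    rw [f.map_sum_finset (fun _ j => a j) (fun _ => S), ← Finset.sum_filter]
    congr 1
    ext J
    simp
  simp_rw [hind, Finset.smul_sum]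
  rw [Finset.sum_comm]
  -- Inclusion–exclusion: the signed sum over the sets `S` containing the image of `J` vanishes
  -- unless that image is everything, so only permutations remain.
  have hJ (J : Fin k → Fin k) :
      ∑ S : Finset (Fin k), (-1 : ℤ) ^ (Sᶜ).card •
        (if (∀ i, J i ∈ S) then f (fun i => a (J i)) else 0) =
      if Function.Bijective J then f (fun i => a (J i)) else 0 := by
    have h1 : ∑ S : Finset (Fin k), (-1 : ℤ) ^ (Sᶜ).card •
        (if (∀ i, J i ∈ S) then f (fun i => a (J i)) else 0) =
        (∑ S : Finset (Fin k), (-1 : ℤ) ^ S.card *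
          (if S ∈ (Finset.univ.image J)ᶜ.powerset then 1 else 0)) • f (fun i => a (J i)) := by
      rw [Finset.sum_smul]
      refine Fintype.sum_equiv compl_involutive.toPerm _ _ (fun S => ?_)
      have : (compl_involutive.toPerm : Equiv.Perm (Finset (Fin k))) S ∈ (Finset.univ.image J)ᶜ.powerset ↔ ∀ i, J i ∈ S := by
        simp only [Function.Involutive.coe_toPerm, Finset.mem_powerset, Finset.compl_subset_compl]
        simp [Finset.subset_iff]
      by_cases h : ∀ i, J i ∈ S
      · rw [if_pos h, if_pos (this.2 h)]
        simp
      · rw [if_neg h, if_neg (fun h' => h (this.1 h'))]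
        simp
    rw [h1]
    simp_rw [mul_ite, mul_one, mul_zero]
    rw [← Finset.sum_filter]
    have h2 : (Finset.univ.filter fun S => S ∈ (Finset.univ.image J)ᶜ.powerset) =
        (Finset.univ.image J)ᶜ.powerset := by ext; simp
    rw [h2, Finset.sum_powerset_neg_one_pow_card]
    have h3 : (Finset.univ.image J)ᶜ = ∅ ↔ Function.Bijective J := by
      rw [Finset.compl_eq_empty_iff, ← Finite.surjective_iff_bijective, Finset.eq_univ_iff_forall]
      simp [Function.Surjective]
    by_cases hb : Function.Bijective J
    · rw [if_pos (h3.2 hb), if_pos hb, one_smul]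
    · rw [if_neg (fun h => hb (h3.1 h)), if_neg hb, zero_smul]
  rw [Finset.sum_congr rfl (fun J _ => hJ J), ← Finset.sum_filter]
  symm
  refine Finset.sum_bij (fun σ _ => (σ : Fin k → Fin k)) (fun σ _ => Finset.mem_filter.2 ⟨Finset.mem_univ _, σ.bijective⟩)
    (fun σ _ τ _ h => Equiv.coe_fn_injective h) (fun J hJ => ?_) (fun _ _ => rfl)
  exact ⟨Equiv.ofBijective J (by simpa using hJ), by simp, rfl⟩

/-- A symmetric multilinear map is determined by its values on the diagonal. -/
theorem eq_zero_of_diagonal_eq_zero {R V W : Type*} [Field R] [CharZero R] [AddCommGroup V]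
    [AddCommGroup W] [Module R V] [Module R W] {k : ℕ}
    (f : MultilinearMap R (fun _ : Fin k => V) W)
    (hf : ∀ (σ : Equiv.Perm (Fin k)) (a : Fin k → V), f (fun i => a (σ i)) = f a)
    (h0 : ∀ a : V, f (fun _ => a) = 0) : f = 0 := by
  ext a
  -- By symmetry the right-hand side is `k! • f a`, and `k!` is invertible in characteristic zero.
  have h := sum_powerset_neg_one_pow_smul_diagonal f a
  simp only [h0, smul_zero, Finset.sum_const_zero, hf, Finset.sum_const, Finset.card_univ,
    Fintype.card_perm, Fintype.card_fin] at h
  rw [← Nat.cast_smul_eq_nsmul R] at h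
  exact (smul_eq_zero.1 h.symm).resolve_left (by exact_mod_cast k.factorial_ne_zero)

end Polarization

/-! ### Parametric integrals and Hadamard's lemma -/

section Hadamard

/-- Differentiating under the integral gives another integral of the same kind, with values in a
space of linear maps; this is why the target `F` varies in the induction on `m`. -/
theorem contDiff_intervalIntegral {E : Type} [NormedAddCommGroup E] [NormedSpace ℝ E]
    [FiniteDimensional ℝ E] (m : ℕ) : ∀ {F : Type} [NormedAddCommGroup F] [NormedSpace ℝ F]
    [CompleteSpace F] {h : E × ℝ → F}, ContDiff ℝ ∞ h → 
    ContDiff ℝ m (fun y => ∫ t in (0 : ℝ)..1, h (y, t)) := by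
  have key {F : Type} [NormedAddCommGroup F] [NormedSpace ℝ F]
    [CompleteSpace F] {h : E × ℝ → F} (hh : ContDiff ℝ ∞ h) (y : E) :
      HasFDerivAt (fun y => ∫ t in (0 : ℝ)..1, h (y, t))
      (∫ t in (0 : ℝ)..1, (fderiv ℝ h (y, t)).comp (ContinuousLinearMap.inl ℝ E ℝ)) y := by
    have hc : Continuous fun p : E × ℝ =>
        (fderiv ℝ h p).comp (ContinuousLinearMap.inl ℝ E ℝ) :=
      (hh.continuous_fderiv (by simp)).clm_comp continuous_const
    -- The dominating constant comes from compactness of the unit ball around `y` times `[0, 1]`.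
    obtain ⟨C, hC⟩ := ((isCompact_closedBall y 1).prod
      (isCompact_uIcc (a := (0 : ℝ)) (b := 1))).exists_bound_of_continuousOn hc.continuousOn
    refine intervalIntegral.hasFDerivAt_integral_of_dominated_of_fderiv_le
      (F := fun y t => h (y, t))
      (F' := fun y t => (fderiv ℝ h (y, t)).comp (ContinuousLinearMap.inl ℝ E ℝ))
      (bound := fun _ => C) (Metric.closedBall_mem_nhds y one_pos) ?_ ?_ ?_ ?_ ?_ ?_
    · exact Filter.Eventually.of_forall fun x =>
        (hh.continuous.comp (by fun_prop)).aestronglyMeasurable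
    · exact (hh.continuous.comp (by fun_prop)).intervalIntegrable _ _
    · exact (hc.comp (by fun_prop : Continuous fun t : ℝ => (y, t))).aestronglyMeasurable
    · exact Filter.Eventually.of_forall fun t ht x hx =>
        hC (x, t) ⟨hx, Set.uIoc_subset_uIcc ht⟩
    · exact intervalIntegrable_const
    · refine Filter.Eventually.of_forall fun t _ x _ => ?_
      have h1 : HasFDerivAt h (fderiv ℝ h (x, t)) (x, t) :=
        (hh.differentiable (by simp) _).hasFDerivAt
      exact h1.comp x (hasFDerivAt_prodMk_left x t)
  induction m with
  | zero =>
    intro F _ _ _ h hh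
    rw [Nat.cast_zero, contDiff_zero]
    exact continuous_iff_continuousAt.2 fun y => (key hh y).continuousAt
  | succ m ih =>
    intro F _ _ _ h hh
    rw [Nat.cast_add, Nat.cast_one]
    refine contDiff_succ_iff_hasFDerivAt.2 ⟨_, ?_, fun y => key hh y⟩
    refine ih (h := fun p => (fderiv ℝ h p).comp (ContinuousLinearMap.inl ℝ E ℝ)) ?_
    exact (hh.fderiv_right (by simp)).clm_comp contDiff_const

/-- Hadamard's lemma. -/
theorem exists_contDiff_eq_sum_mul {n : ℕ} (f : RSpace n → ℂ) (hf : ContDiff ℝ ∞ f)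
    (a : RSpace n) : ∃ g : Fin n → RSpace n → ℂ, (∀ j, ContDiff ℝ ∞ (g j)) ∧
      (∀ j, g j a = fderiv ℝ f a (EuclideanSpace.single j 1)) ∧
      ∀ y, f y = f a + ∑ j, (y j - a j : ℝ) * g j y := by
  -- These coefficients come from the fundamental theorem of calculus along the segment from `a` to
  -- `y`.
  refine ⟨fun j y => ∫ t in (0 : ℝ)..1, fderiv ℝ f (a + t • (y - a)) (EuclideanSpace.single j 1),
    fun j => ?_, fun j => by simp, fun y => ?_⟩
  · refine contDiff_infty.2 fun m => contDiff_intervalIntegral m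
      (h := fun p : RSpace n × ℝ => fderiv ℝ f (a + p.2 • (p.1 - a)) (EuclideanSpace.single j 1)) ?_
    refine ContDiff.clm_apply ?_ contDiff_const
    exact (hf.fderiv_right (m := ∞) (by simp)).comp (by fun_prop)
  · have hc : Continuous fun t : ℝ => fderiv ℝ f (a + t • (y - a)) :=
      (hf.continuous_fderiv (by simp)).comp (by fun_prop)
    have h1 : ∫ t in (0 : ℝ)..1, fderiv ℝ f (a + t • (y - a)) (y - a) = f y - f a := by
      rw [intervalIntegral.integral_eq_sub_of_hasDerivAt (f := fun t : ℝ => f (a + t • (y - a)))]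
      · simp
      · intro t _
        have h2 : HasFDerivAt f (fderiv ℝ f (a + t • (y - a))) (a + t • (y - a)) :=
          (hf.differentiable (by simp) _).hasFDerivAt
        have h3 : HasDerivAt (fun t : ℝ => a + t • (y - a)) (y - a) t := by
          simpa using ((hasDerivAt_id t).smul_const (y - a)).const_add a
        exact h2.comp_hasDerivAt t h3
      · exact (hc.clm_apply continuous_const).intervalIntegrable _ _
    have h4 : y - a = ∑ j, (y j - a j) • EuclideanSpace.single j (1 : ℝ) := by
      ext i
      simp [Finset.sum_apply, Pi.single_apply]
    have h5 : ∀ t : ℝ, fderiv ℝ f (a + t • (y - a)) (y - a) =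
        ∑ j, ((y j - a j : ℝ) : ℂ) *
          fderiv ℝ f (a + t • (y - a)) (EuclideanSpace.single j 1) := by
      intro t
      have := congrArg (fderiv ℝ f (a + t • (y - a))) h4
      rw [map_sum] at this
      rw [this]
      simp
    simp_rw [h5] at h1
    rw [intervalIntegral.integral_finsetSum] at h1
    · simp_rw [intervalIntegral.integral_const_mul] at h1
      rw [h1]; ring
    · intro j _
      exact (continuous_const.mul (hc.clm_apply continuous_const)).intervalIntegrable _ _

end Hadamard

/-! ### The algebra of smooth functions and first derivatives -/

section SmoothFunctions

variable {n : ℕ} {M : Type*} [TopologicalSpace M] [ChartedSpace (RSpace n) M]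

/-- Evaluation at a point, as an algebra homomorphism. -/
def evalHom (x : M) : SmoothFun n M →ₐ[ℂ] ℂ where
  toFun f := f x
  map_one' := rfl
  map_mul' _ _ := rfl
  map_zero' := rfl
  map_add' _ _ := rfl
  commutes' _ := rfl

theorem mem_vanishingIdeal {x : M} {f : SmoothFun n M} : f ∈ vanishingIdeal x ↔ f x = 0 := Iff.rfl

theorem vanishingIdeal_eq_ker (x : M) : vanishingIdeal (n := n) x = RingHom.ker (evalHom x) := rfl

theorem evalHom_apply (x : M) (f : SmoothFun n M) : evalHom x f = f x := rfl

theorem SmoothFun.ext {f g : SmoothFun n M} (h : ∀ x, f x = g x) : f = g :=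
  Subtype.ext (funext h)

theorem SmoothFun.contMDiff (f : SmoothFun n M) : ContMDiff (𝓡 n) 𝓘(ℝ, ℂ) ∞ f.1 := f.2

theorem SmoothFun.mdifferentiableAt (f : SmoothFun n M) (x : M) :
    MDifferentiableAt (𝓡 n) 𝓘(ℝ, ℂ) f.1 x := f.contMDiff.mdifferentiableAt (by simp)

/-- A smooth real function, seen as a complex one. -/
def ofRealFun (f : M → ℝ) (hf : ContMDiff (𝓡 n) 𝓘(ℝ, ℝ) ∞ f) : SmoothFun n M :=
  ⟨fun x => (f x : ℂ), Complex.ofRealCLM.contDiff.contMDiff.comp hf⟩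

/-- Duality forces `e` to be linearly independent, and `n` independent vectors span. Every change of
frame below goes through these two expansions. -/
theorem sum_smul_of_dual {x : M} {α : Fin n → CotSpace n x} {e : Fin n → TangentSpace (𝓡 n) x}
    (h : ∀ i j, α i (e j) = if i = j then 1 else 0) :
    (∀ v : TangentSpace (𝓡 n) x, v = ∑ i, α i v • e i) ∧
    ∀ β : CotSpace n x, β = ∑ i, β (e i) • α i := by
  have hli : LinearIndependent ℝ e := by
    rw [Fintype.linearIndependent_iff]
    intro c hc i
    have := congrArg (α i) hc
    simpa [h] using this
  have : FiniteDimensional ℝ (TangentSpace (𝓡 n) x) :=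
    inferInstanceAs (FiniteDimensional ℝ (RSpace n))
  have hspan : Submodule.span ℝ (Set.range e) = ⊤ :=
    hli.span_eq_top_of_card_eq_finrank' (by
      have : Module.finrank ℝ (TangentSpace (𝓡 n) x) = Module.finrank ℝ (RSpace n) := rfl
      rw [this]; simp)
  have h1 : ∀ v : TangentSpace (𝓡 n) x, v = ∑ i, α i v • e i := by
    intro v
    have hv : v ∈ Submodule.span ℝ (Set.range e) := hspan ▸ Submodule.mem_top
    obtain ⟨c, rfl⟩ := (Submodule.mem_span_range_iff_exists_fun ℝ).1 hv
    simp [h]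
  refine ⟨h1, fun β => ?_⟩
  ext v
  conv_lhs => rw [h1 v]
  simp [mul_comm]

theorem mvfderiv_complex_mul {f g : M → ℂ} {x : M} (hf : MDifferentiableAt (𝓡 n) 𝓘(ℝ, ℂ) f x)
    (hg : MDifferentiableAt (𝓡 n) 𝓘(ℝ, ℂ) g x) (v : TangentSpace (𝓡 n) x) :
    mvfderiv (𝓡 n) (fun y => f y * g y) x v =
      f x * mvfderiv (𝓡 n) g x v + mvfderiv (𝓡 n) f x v * g x := by
  have := (hf.hasMFDerivAt.mul' hg.hasMFDerivAt).mfderiv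
  rw [mvfderiv, show (fun y => f y * g y) = f * g from rfl, this]
  rfl

theorem mvfderiv_ofReal {f : M → ℝ} {x : M} (hf : MDifferentiableAt (𝓡 n) 𝓘(ℝ, ℝ) f x)
    (v : TangentSpace (𝓡 n) x) :
    mvfderiv (𝓡 n) (fun y => (f y : ℂ)) x v = (mvfderiv (𝓡 n) f x v : ℝ) := by
  have h1 : MDifferentiableAt 𝓘(ℝ, ℝ) 𝓘(ℝ, ℂ) (Complex.ofRealCLM : ℝ → ℂ) (f x) :=
    Complex.ofRealCLM.differentiableAt.mdifferentiableAt
  have := mfderiv_comp x h1 hf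
  rw [mvfderiv, show (fun y => (f y : ℂ)) = Complex.ofRealCLM ∘ f from rfl, this, mfderiv_eq_fderiv,
    ContinuousLinearMap.fderiv]
  rfl

theorem mvfderiv_congr {F : Type*} [NormedAddCommGroup F] [NormedSpace ℝ F] {f g : M → F} {x : M}
    (h : f =ᶠ[nhds x] g) : mvfderiv (𝓡 n) f x = mvfderiv (𝓡 n) g x := by
  have := h.mfderiv_eq (I := 𝓡 n) (I' := 𝓘(ℝ, F))
  have h2 := h.eq_of_nhds
  ext v
  simp only [mvfderiv, ContinuousLinearMap.comp_apply]
  rw [this]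
  rfl

end SmoothFunctions

/-! ### Smooth vector fields as derivations -/

section Fields

variable {n : ℕ} {M : Type*} [TopologicalSpace M] [ChartedSpace (RSpace n) M]
  [IsManifold (𝓡 n) ∞ M]

variable (n M) in
/-- The smooth real vector fields on `M`. -/
abbrev VField : Type _ :=
  ContMDiffSection (𝓡 n) (RSpace n) ∞ (TangentSpace (𝓡 n) : M → Type _)

/-- The derivative of `f` along `X` is the fibre component of the tangent map of `f` composed with
the section `X`, so no coordinates are needed. -/
theorem mdifferentiableAt_mvfderiv_apply {F : Type*} [NormedAddCommGroup F] [NormedSpace ℝ F]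
    {f : M → F} (hf : ContMDiff (𝓡 n) 𝓘(ℝ, F) ∞ f) {X : Π x : M, TangentSpace (𝓡 n) x} {x : M}
    (hX : MDifferentiableAt (𝓡 n) (𝓡 n).tangent
      (fun y => (⟨y, X y⟩ : TangentBundle (𝓡 n) M)) x) :
    MDifferentiableAt (𝓡 n) 𝓘(ℝ, F) (fun y => mvfderiv (𝓡 n) f y (X y)) x := by
  have h1 := hf.contMDiff_tangentMap (m := ∞) (by simp)
  have h2 := (h1.mdifferentiableAt (by simp)).comp x hX
  exact ((contMDiff_snd_tangentBundle_modelSpace (n := 1) F 𝓘(ℝ, F)).mdifferentiableAt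
    (by simp)).comp x h2

theorem contMDiffAt_mvfderiv_apply {F : Type*} [NormedAddCommGroup F] [NormedSpace ℝ F]
    {f : M → F} (hf : ContMDiff (𝓡 n) 𝓘(ℝ, F) ∞ f) {X : Π x : M, TangentSpace (𝓡 n) x} {x : M}
    (hX : ContMDiffAt (𝓡 n) (𝓡 n).tangent ∞
      (fun y => (⟨y, X y⟩ : TangentBundle (𝓡 n) M)) x) :
    ContMDiffAt (𝓡 n) 𝓘(ℝ, F) ∞ (fun y => mvfderiv (𝓡 n) f y (X y)) x := by
  have h1 := hf.contMDiff_tangentMap (m := ∞) (by simp)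
  have h2 := h1.contMDiffAt.comp x hX
  exact (contMDiff_snd_tangentBundle_modelSpace F 𝓘(ℝ, F)).contMDiffAt.comp x h2

/-- The derivative of a smooth function along a smooth vector field. -/
def VField.deriv (X : VField n M) (f : SmoothFun n M) : SmoothFun n M :=
  ⟨fun x => mvfderiv (𝓡 n) f.1 x (X x), fun _ =>
    contMDiffAt_mvfderiv_apply f.contMDiff X.contMDiff.contMDiffAt⟩

theorem VField.deriv_mul (X : VField n M) (f g : SmoothFun n M) :
    X.deriv (f * g) = f * X.deriv g + X.deriv f * g :=
  SmoothFun.ext fun x => mvfderiv_complex_mul (f.mdifferentiableAt x) (g.mdifferentiableAt x) _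

theorem VField.deriv_add (X : VField n M) (f g : SmoothFun n M) :
    X.deriv (f + g) = X.deriv f + X.deriv g :=
  SmoothFun.ext fun x => by
    have := mvfderiv_add (f.mdifferentiableAt x) (g.mdifferentiableAt x)
    exact congrArg (fun L => L (X x)) this

theorem VField.deriv_sub (X : VField n M) (f g : SmoothFun n M) :
    X.deriv (f - g) = X.deriv f - X.deriv g := by
  rw [eq_sub_iff_add_eq, ← deriv_add, sub_add_cancel]

theorem VField.deriv_algebraMap (X : VField n M) (c : ℂ) :
    X.deriv (algebraMap ℂ _ c) = 0 :=
  SmoothFun.ext fun x => by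
    have := mvfderiv_const (I := 𝓡 n) (x := x) c
    exact congrArg (fun L => L (X x)) this

theorem VField.deriv_smul (X : VField n M) (c : ℂ) (f : SmoothFun n M) :
    X.deriv (c • f) = c • X.deriv f := by
  rw [Algebra.smul_def, deriv_mul, deriv_algebraMap, zero_mul, add_zero, ← Algebra.smul_def]

/-- By the Leibniz rule a derivation removes at most one factor from a product of elements of `𝔪_x`.
-/
theorem VField.deriv_mem_pow (X : VField n M) (x : M) (s : ℕ) :
    ∀ f ∈ (vanishingIdeal x : Ideal (SmoothFun n M)) ^ (s + 1),
      X.deriv f ∈ (vanishingIdeal x : Ideal (SmoothFun n M)) ^ s := by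
  induction s with
  | zero => intro f _; simp
  | succ s ih =>
    intro f hf
    rw [pow_succ] at hf
    refine Submodule.mul_induction_on hf (fun a ha b hb => ?_) (fun a b ha hb => ?_)
    · rw [deriv_mul]
      refine add_mem (Ideal.mul_mem_right _ _ ha) ?_
      rw [pow_succ]
      exact Ideal.mul_mem_mul (ih a ha) hb
    · rw [deriv_add]
      exact add_mem ha hb

theorem VField.deriv_pow (X : VField n M) (f : SmoothFun n M) (s : ℕ) :
    X.deriv (f ^ (s + 1)) = ((s + 1 : ℕ) : ℂ) • (f ^ s * X.deriv f) := by
  induction s with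
  | zero => simp
  | succ s ih =>
    rw [pow_succ, deriv_mul, ih]
    simp only [Algebra.smul_def, map_natCast]
    push_cast
    ring

end Fields

/-! ### Global functions and fields that are coordinates near a point -/

section Frames

variable {n : ℕ} {M : Type*} [TopologicalSpace M] [ChartedSpace (RSpace n) M]
  [IsManifold (𝓡 n) ∞ M] [T2Space M]

/-- Smooth functions and vector fields on `M` that near `x₀` are local coordinates and the
associated frame. -/
theorem exists_coord_frame (x₀ : M) : ∃ (ξ : Fin n → M → ℝ) (E : Fin n → VField n M),
    (∀ i, ContMDiff (𝓡 n) 𝓘(ℝ, ℝ) ∞ (ξ i)) ∧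
    ∀ᶠ y in nhds x₀, ∀ i j, mvfderiv (𝓡 n) (ξ i) y (E j y) = if i = j then 1 else 0 := by
  -- Multiplying by a bump function makes the chart coordinates and the local frame global without
  -- changing them near `x₀`.
  let χ : SmoothBumpFunction (𝓡 n) x₀ := Classical.arbitrary _
  let e := trivializationAt (RSpace n) (TangentSpace (𝓡 n) : M → Type _) x₀
  let b := (EuclideanSpace.basisFun (Fin n) ℝ).toBasis
  have hbase : e.baseSet = (chartAt (RSpace n) x₀).source := by
    simp [e]
  have hE : ∀ j, ContMDiff (𝓡 n) (𝓡 n).tangent ∞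
      (fun y => (⟨y, ((χ : M → ℝ) • e.localFrame b j) y⟩ : TangentBundle (𝓡 n) M)) := fun j => by
    refine ContMDiffOn.smul_section_of_tsupport (u := e.baseSet) χ.contMDiff.contMDiffOn
      e.open_baseSet ?_ (e.contMDiffOn_localFrame_baseSet ∞ b j)
    rw [hbase]
    exact χ.tsupport_subset_chartAt_source
  refine ⟨fun i y => χ y • (extChartAt (𝓡 n) x₀ y) i, fun j => ⟨_, hE j⟩, fun i => ?_, ?_⟩
  · refine χ.contMDiff_smul (g := fun y => (extChartAt (𝓡 n) x₀ y) i) ?_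
    exact (EuclideanSpace.proj (𝕜 := ℝ) i).contDiff.contMDiff.comp_contMDiffOn
      (contMDiffOn_extChartAt (n := ∞))
  · have h1 := χ.eventuallyEq_one.eventually_nhds
    have h2 : ∀ᶠ y in nhds x₀, y ∈ (chartAt (RSpace n) x₀).source :=
      (chartAt (RSpace n) x₀).open_source.mem_nhds (mem_chart_source _ x₀)
    filter_upwards [h1, h2] with y hy hy2 i j
    have h3 : (fun y => χ y • (extChartAt (𝓡 n) x₀ y) i) =ᶠ[nhds y]
        (EuclideanSpace.proj (𝕜 := ℝ) i) ∘ (extChartAt (𝓡 n) x₀) := by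
      filter_upwards [hy] with z hz
      simp [hz]
    have hy' : χ y = 1 := hy.self_of_nhds
    have h4 : MDifferentiableAt (𝓡 n) 𝓘(ℝ, RSpace n) (extChartAt (𝓡 n) x₀) y :=
      mdifferentiableAt_extChartAt hy2
    have h5 : MDifferentiableAt 𝓘(ℝ, RSpace n) 𝓘(ℝ, ℝ) (EuclideanSpace.proj (𝕜 := ℝ) i)
        (extChartAt (𝓡 n) x₀ y) :=
      (EuclideanSpace.proj (𝕜 := ℝ) i).differentiableAt.mdifferentiableAt
    have h6 := mfderiv_comp y h5 h4
    have h7 : mvfderiv (𝓡 n) ((EuclideanSpace.proj (𝕜 := ℝ) i) ∘ (extChartAt (𝓡 n) x₀)) y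
        (((χ : M → ℝ) • e.localFrame b j) y) =
        (EuclideanSpace.proj (𝕜 := ℝ) i) (e.continuousLinearMapAt ℝ y (e.localFrame b j y)) := by
      rw [TangentBundle.continuousLinearMapAt_trivializationAt hy2, mvfderiv, h6,
        mfderiv_eq_fderiv, ContinuousLinearMap.fderiv]
      simp only [Pi.smul_apply', hy', one_smul]
      rfl
    have hyb : y ∈ e.baseSet := hbase ▸ hy2
    rw [mvfderiv_congr h3]
    refine h7.trans ?_
    rw [e.localFrame_apply_of_mem_baseSet b hyb]
    simp [Trivialization.basisAt, b, hyb]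

theorem exists_vField_eq (x : M) (v : TangentSpace (𝓡 n) x) : ∃ X : VField n M, X x = v := by
  obtain ⟨ξ, E, -, h⟩ := exists_coord_frame (n := n) x
  have h1 := (sum_smul_of_dual h.self_of_nhds).1 v
  refine ⟨∑ i, (mvfderiv (𝓡 n) (ξ i) x v) • E i, ?_⟩
  conv_rhs => rw [h1]
  have : (⇑(∑ i, (mvfderiv (𝓡 n) (ξ i) x v) • E i)) = ∑ i, ⇑((mvfderiv (𝓡 n) (ξ i) x v) • E i) :=
    map_sum (ContMDiffSection.coeAddHom (𝓡 n) (RSpace n) ∞ (TangentSpace (𝓡 n) : M → Type _)) _ _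
  rw [this]
  simp

/-- A smooth function that vanishes at `x` together with its differential lies in the square of
the vanishing ideal. -/
theorem mem_vanishingIdeal_sq {x : M} {f : SmoothFun n M} (hf : f x = 0)
    (hdf : mvfderiv (𝓡 n) f.1 x = 0) :
    f ∈ (vanishingIdeal x : Ideal (SmoothFun n M)) ^ 2 := by
  let χ : SmoothBumpFunction (𝓡 n) x := Classical.arbitrary _
  let φ := extChartAt (𝓡 n) x
  let a := φ x
  -- The chart expression of `f`, cut off and extended by zero, is smooth on the whole model space,
  -- as Hadamard's lemma requires.
  let h : RSpace n → ℂ := fun y => χ.toContDiffBump y • f.1 (φ.symm y)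
  have hball : Metric.closedBall a χ.rOut ⊆ φ.target := fun z hz =>
    χ.closedBall_subset ⟨hz, by simp⟩
  have hts : tsupport χ.toContDiffBump ⊆ φ.target := by
    rw [ContDiffBump.tsupport_eq]; exact hball
  have hto : IsOpen φ.target := isOpen_extChartAt_target x
  have hsymm : ∀ y ∈ φ.target, ContMDiffAt 𝓘(ℝ, RSpace n) 𝓘(ℝ, ℂ) ∞ (f.1 ∘ φ.symm) y :=
    fun y hy => f.contMDiff.contMDiffAt.comp y
      ((contMDiffOn_extChartAt_symm x).contMDiffAt (hto.mem_nhds hy))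
  have hh : ContDiff ℝ ∞ h := by
    rw [contDiff_iff_contDiffAt]
    intro y
    by_cases hy : y ∈ tsupport χ.toContDiffBump
    · exact χ.toContDiffBump.contDiffAt.smul (hsymm y (hts hy)).contDiffAt
    · refine (contDiffAt_const (c := (0 : ℂ))).congr_of_eventuallyEq ?_
      have := notMem_tsupport_iff_eventuallyEq.1 hy
      filter_upwards [this] with z hz
      have hz' : χ.toContDiffBump z = 0 := hz
      simp only [h]
      rw [hz', zero_smul]
  obtain ⟨g, hg, hga, hgs⟩ := exists_contDiff_eq_sum_mul h hh a
  have hxs : x ∈ φ.source := mem_extChartAt_source x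
  have hha : h a = 0 := by
    simp [h, a, φ, hf]
  have hdh : fderiv ℝ h a = 0 := by
    have h1 : h =ᶠ[nhds a] f.1 ∘ φ.symm := by
      filter_upwards [χ.toContDiffBump.eventuallyEq_one] with z hz
      have hz' : χ.toContDiffBump z = 1 := hz
      simp only [h]
      rw [hz', one_smul]
      rfl
    rw [h1.fderiv_eq, ← mfderiv_eq_fderiv]
    have h2 : MDifferentiableAt 𝓘(ℝ, RSpace n) (𝓡 n) φ.symm a :=
      ((contMDiffOn_extChartAt_symm (n := ∞) x).contMDiffAt
        (hto.mem_nhds (φ.map_source hxs))).mdifferentiableAt (by simp)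
    have h4 : φ.symm a = x := φ.left_inv hxs
    have h3 := mfderiv_comp_of_eq (f.mdifferentiableAt x) h2 h4
    exact h3.trans ((congrArg (fun L => L ∘SL mfderiv 𝓘(ℝ, RSpace n) (𝓡 n) φ.symm a)
      (h4.symm ▸ hdf)).trans (ContinuousLinearMap.zero_comp _))
  have hχ : ∀ y ∈ φ.source, χ y = χ.toContDiffBump (φ y) := fun y hy =>
    χ.eqOn_source (by simpa [φ] using hy)
  have hχ0 : ∀ y, y ∉ φ.source → χ y = 0 := fun y hy => by
    by_contra h0
    exact hy (by simpa [φ] using χ.support_subset_source h0)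
  let X : SmoothFun n M := ofRealFun χ χ.contMDiff
  have hφ : ContMDiffOn (𝓡 n) 𝓘(ℝ, RSpace n) ∞ φ (chartAt (RSpace n) x).source :=
    contMDiffOn_extChartAt
  let u : Fin n → SmoothFun n M := fun j => ⟨fun y => χ y • ((φ y j - a j : ℝ) : ℂ),
    χ.contMDiff_smul (g := fun y => ((φ y j - a j : ℝ) : ℂ))
      ((show ContDiff ℝ ∞ fun y : RSpace n => ((y j - a j : ℝ) : ℂ) from
        Complex.ofRealCLM.contDiff.comp
          ((EuclideanSpace.proj (𝕜 := ℝ) j).contDiff.sub contDiff_const)).contMDiff.comp_contMDiffOn hφ)⟩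
  let w : Fin n → SmoothFun n M := fun j => ⟨fun y => χ y • g j (φ y),
    χ.contMDiff_smul (g := fun y => g j (φ y)) ((hg j).contMDiff.comp_contMDiffOn hφ)⟩
  have hu : ∀ j, u j ∈ vanishingIdeal x := fun j => by
    rw [mem_vanishingIdeal]
    simp [u, a]
  have hw : ∀ j, w j ∈ vanishingIdeal x := fun j => by
    rw [mem_vanishingIdeal]
    have : g j (φ x) = 0 := by rw [hga, hdh]; rfl
    simp [w, this]
  have hX : 1 - X ^ 3 ∈ vanishingIdeal x := by
    rw [vanishingIdeal_eq_ker, RingHom.mem_ker, map_sub, map_one, map_pow]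
    have : evalHom x X = 1 := by
      change ((χ x : ℝ) : ℂ) = 1
      simp
    rw [this]; simp
  -- One factor of the bump function sits in `h`, one in each `u j` and one in each `w j`; this
  -- explains the cube.
  have hmain : X ^ 3 * f = ∑ j, u j * w j := by
    refine SmoothFun.ext fun y => ?_
    have e1 : (X ^ 3 * f) y = (χ y : ℂ) ^ 3 * f y := rfl
    have e2 : (∑ j, u j * w j).1 y =
        ∑ j, ((χ y : ℂ) * ((φ y j - a j : ℝ) : ℂ)) * ((χ y : ℂ) * g j (φ y)) := by
      have := map_sum (evalHom (n := n) y) (fun j => u j * w j) Finset.univ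
      exact this
    rw [e1, e2]
    by_cases hy : y ∈ φ.source
    · have e3 := hgs (φ y)
      have e4 : h (φ y) = (χ y : ℂ) * f y := by
        simp only [h, hχ y hy, φ.left_inv hy]
        simp
      rw [e4, hha, zero_add] at e3
      calc (χ y : ℂ) ^ 3 * f y = (χ y : ℂ) ^ 2 * ((χ y : ℂ) * f y) := by ring
        _ = _ := by
          rw [e3, Finset.mul_sum]
          exact Finset.sum_congr rfl fun j _ => by ring
    · simp [hχ0 y hy]
  -- Both `1 - X ^ 3` and `f` vanish at `x`, so the correction term is itself a product of two
  -- elements of `𝔪_x`.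
  have hfin : f = (∑ j, u j * w j) + (1 - X ^ 3) * f := by rw [← hmain]; ring
  rw [hfin, pow_two]
  exact add_mem (sum_mem fun j _ => Ideal.mul_mem_mul (hu j) (hw j)) (Ideal.mul_mem_mul hX hf)

end Frames

/-! ### Covariant differentials of tensor fields are tensors -/

section CovariantTensors

variable {n : ℕ} {M : Type*} [TopologicalSpace M] [ChartedSpace (RSpace n) M]
  [IsManifold (𝓡 n) ∞ M]

/-- A smooth complex covariant tensor field of order `k`. -/
structure IsSmoothTensor {k : ℕ} (t : Π x : M, (Fin k → TangentSpace (𝓡 n) x) → ℂ) : Prop where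
  exists_multilinear : ∀ x, ∃ m : MultilinearMap ℝ (fun _ : Fin k => TangentSpace (𝓡 n) x) ℂ,
    ∀ v, t x v = m v
  contMDiff : ∀ V : Fin k → VField n M,
    ContMDiff (𝓡 n) 𝓘(ℝ, ℂ) ∞ (fun x => t x (fun i => V i x))

/-- The evaluation of a smooth covariant tensor field on smooth vector fields. -/
def IsSmoothTensor.eval {k : ℕ} {t : Π x : M, (Fin k → TangentSpace (𝓡 n) x) → ℂ}
    (ht : IsSmoothTensor t) (V : Fin k → VField n M) : SmoothFun n M :=
  ⟨fun x => t x (fun i => V i x), ht.contMDiff V⟩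

/-- Smoothness of `t` is given only on global smooth fields. Expanding the `V i` in a local frame
transfers it to fields that are merely differentiable at `x`. -/
theorem IsSmoothTensor.mdifferentiableAt [T2Space M] {k : ℕ}
    {t : Π x : M, (Fin k → TangentSpace (𝓡 n) x) → ℂ}
    (ht : IsSmoothTensor t) {x : M} {V : Fin k → Π y : M, TangentSpace (𝓡 n) y}
    (hV : ∀ i, MDifferentiableAt (𝓡 n) (𝓡 n).tangent
      (fun y => (⟨y, V i y⟩ : TangentBundle (𝓡 n) M)) x) :
    MDifferentiableAt (𝓡 n) 𝓘(ℝ, ℂ) (fun y => t y (fun i => V i y)) x := by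
  classical
  obtain ⟨ξ, E, hξ, h⟩ := exists_coord_frame (n := n) x
  have h1 : (fun y => t y (fun i => V i y)) =ᶠ[nhds x] fun y => ∑ J : Fin k → Fin n,
      (∏ i, mvfderiv (𝓡 n) (ξ (J i)) y (V i y)) • t y (fun i => E (J i) y) := by
    filter_upwards [h] with y hy
    obtain ⟨m, hm⟩ := ht.exists_multilinear y
    have h2 := (sum_smul_of_dual hy).1
    have h3 : (fun i => V i y) =
        fun i => ∑ j, mvfderiv (𝓡 n) (ξ j) y (V i y) • E j y := funext fun i => h2 (V i y)
    simp only [hm]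
    rw [h3, m.map_sum]
    exact Finset.sum_congr rfl fun J _ => m.map_smul_univ _ _
  refine MDifferentiableAt.congr_of_eventuallyEq ?_ h1
  have h4 : ∀ J : Fin k → Fin n, MDifferentiableAt (𝓡 n) 𝓘(ℝ, ℂ) (fun y =>
      (∏ i, mvfderiv (𝓡 n) (ξ (J i)) y (V i y)) • t y (fun i => E (J i) y)) x := fun J => by
    have hprod : MDifferentiableAt (𝓡 n) 𝓘(ℝ, ℝ)
        (fun y => ∏ i, mvfderiv (𝓡 n) (ξ (J i)) y (V i y)) x := by
      have := MDifferentiableAt.prod (I := 𝓡 n) (z := x) (t := Finset.univ)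
        (f := fun i y => mvfderiv (𝓡 n) (ξ (J i)) y (V i y))
        (fun i _ => mdifferentiableAt_mvfderiv_apply (hξ _) (hV i))
      convert! this using 1
      ext y; rw [Finset.prod_apply]
    exact hprod.smul ((ht.contMDiff fun i => E (J i)).mdifferentiableAt (by simp))
  have h5 := MDifferentiableAt.sum (I := 𝓡 n) (z := x) (t := Finset.univ) (fun J _ => h4 J)
  convert h5 using 1
  ext y; simp

variable (nabla : CovariantDerivative (𝓡 n) (RSpace n) (TangentSpace (𝓡 n) : M → Type _))

/-- The covariant differential of `t` along `v₀`, evaluated on vector fields `V`. -/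
def covDiffAlong {k : ℕ} (t : Π x : M, (Fin k → TangentSpace (𝓡 n) x) → ℂ) (x : M)
    (v₀ : TangentSpace (𝓡 n) x) (V : Fin k → Π y : M, TangentSpace (𝓡 n) y) : ℂ :=
  mvfderiv (𝓡 n) (fun y => t y (fun i => V i y)) x v₀
    - ∑ i : Fin k, t x (Function.update (fun j => V j x) i (nabla (V i) x v₀))

theorem covDiff_eq_covDiffAlong {k : ℕ} (t : Π x : M, (Fin k → TangentSpace (𝓡 n) x) → ℂ) (x : M)
    (v : Fin (k + 1) → TangentSpace (𝓡 n) x) :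
    covDiff nabla t x v =
      covDiffAlong nabla t x (v 0) (fun i => FiberBundle.extend (RSpace n) (v i.succ)) := by
  simp [covDiff, covDiffAlong]

/-- Isolates everything that depends on the `i`-th slot, in preparation for the tensoriality proof.
-/
theorem covDiffAlong_update {k : ℕ} {t : Π x : M, (Fin k → TangentSpace (𝓡 n) x) → ℂ} {x : M}
    {m : MultilinearMap ℝ (fun _ : Fin k => TangentSpace (𝓡 n) x) ℂ} (hm : ∀ v, t x v = m v)
    (v₀ : TangentSpace (𝓡 n) x) (V : Fin k → Π y : M, TangentSpace (𝓡 n) y) (i : Fin k)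
    (W : Π y : M, TangentSpace (𝓡 n) y) :
    covDiffAlong nabla t x v₀ (Function.update V i W) =
      mvfderiv (𝓡 n) (fun y => t y (Function.update (fun j => V j y) i (W y))) x v₀
        - (m (Function.update (fun j => V j x) i (nabla W x v₀)) +
          ∑ j ∈ Finset.univ.erase i, m (Function.update
            (Function.update (fun l => V l x) j (nabla (V j) x v₀)) i (W x))) := by
  have hu (y : M) : (fun j => Function.update V i W j y) =
      Function.update (fun j => V j y) i (W y) := by
    ext j
    by_cases h : j = i
    · subst h; simp
    · simp [h]
  simp only [covDiffAlong, hu, hm]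
  rw [← Finset.add_sum_erase _ _ (Finset.mem_univ i)]
  congr 2
  · simp
  · refine Finset.sum_congr rfl fun j hj => ?_
    have hji := Finset.ne_of_mem_erase hj
    rw [Function.update_of_ne hji, Function.update_comm hji]

/-- When the `i`-th field is multiplied by `f`, the term with `df` from differentiating the value of
`t` cancels the one from the Leibniz rule of the connection. -/
theorem tensorialAt_covDiffAlong [T2Space M] {k : ℕ}
    {t : Π x : M, (Fin k → TangentSpace (𝓡 n) x) → ℂ} (ht : IsSmoothTensor t) {x : M}
    (v₀ : TangentSpace (𝓡 n) x) {V : Fin k → Π y : M, TangentSpace (𝓡 n) y}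
    (hV : ∀ i, MDifferentiableAt (𝓡 n) (𝓡 n).tangent
      (fun y => (⟨y, V i y⟩ : TangentBundle (𝓡 n) M)) x) (i : Fin k) :
    TensorialAt (𝓡 n) (RSpace n)
      (fun W => covDiffAlong nabla t x v₀ (Function.update V i W)) x := by
  obtain ⟨m, hm⟩ := ht.exists_multilinear x
  have hd {W : Π y : M, TangentSpace (𝓡 n) y} (hW : MDifferentiableAt (𝓡 n) (𝓡 n).tangent
      (fun y => (⟨y, W y⟩ : TangentBundle (𝓡 n) M)) x) :
      MDifferentiableAt (𝓡 n) 𝓘(ℝ, ℂ)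
        (fun y => t y (Function.update (fun j => V j y) i (W y))) x := by
    have := ht.mdifferentiableAt (V := Function.update V i W) (x := x) (fun j => by
      by_cases h : j = i
      · subst h; simpa using hW
      · simpa [h] using hV j)
    convert this using 3 with y
    ext j
    by_cases h : j = i
    · subst h; simp
    · simp [h]
  constructor
  · intro f W hf hW
    have e1 : (fun y => t y (Function.update (fun j => V j y) i ((f • W) y))) =
        f • fun y => t y (Function.update (fun j => V j y) i (W y)) := by
      ext y
      obtain ⟨m', hm'⟩ := ht.exists_multilinear y
      simp [hm', m'.map_update_smul]
    rw [covDiffAlong_update nabla hm, covDiffAlong_update nabla hm, e1, mvfderiv_smul hf (hd hW),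
      nabla.isCovariantDerivativeOnUniv.leibniz hW hf]
    simp only [add_apply, smul_apply,
      ContinuousLinearMap.smulRight_apply, m.map_update_add, m.map_update_smul, Pi.smul_apply',
      ← Finset.smul_sum, hm]
    module
  · intro W W' hW hW'
    have e1 : (fun y => t y (Function.update (fun j => V j y) i ((W + W') y))) =
        (fun y => t y (Function.update (fun j => V j y) i (W y))) +
        (fun y => t y (Function.update (fun j => V j y) i (W' y))) := by
      ext y
      obtain ⟨m', hm'⟩ := ht.exists_multilinear y
      simp [hm', m'.map_update_add]
    rw [covDiffAlong_update nabla hm, covDiffAlong_update nabla hm, covDiffAlong_update nabla hm,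
      e1, mvfderiv_add (hd hW) (hd hW'), nabla.isCovariantDerivativeOnUniv.add hW hW']
    simp only [add_apply, m.map_update_add, Pi.add_apply,
      Finset.sum_add_distrib]
    ring

/-- Tensoriality allows one slot at a time to be replaced; the set `s` in the induction records the
slots already replaced. -/
theorem covDiffAlong_congr [T2Space M] {k : ℕ}
    {t : Π x : M, (Fin k → TangentSpace (𝓡 n) x) → ℂ} (ht : IsSmoothTensor t) {x : M}
    (v₀ : TangentSpace (𝓡 n) x) {V V' : Fin k → Π y : M, TangentSpace (𝓡 n) y}
    (hV : ∀ i, MDifferentiableAt (𝓡 n) (𝓡 n).tangent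
      (fun y => (⟨y, V i y⟩ : TangentBundle (𝓡 n) M)) x)
    (hV' : ∀ i, MDifferentiableAt (𝓡 n) (𝓡 n).tangent
      (fun y => (⟨y, V' i y⟩ : TangentBundle (𝓡 n) M)) x) (h : ∀ i, V i x = V' i x) :
    covDiffAlong nabla t x v₀ V = covDiffAlong nabla t x v₀ V' := by
  classical
  have key (s : Finset (Fin k)) :
      covDiffAlong nabla t x v₀ (s.piecewise V' V) = covDiffAlong nabla t x v₀ V := by
    induction s using Finset.induction_on with
    | empty => simp
    | insert j s hj ih =>
      have hp (i : Fin k) : MDifferentiableAt (𝓡 n) (𝓡 n).tangent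
          (fun y => (⟨y, s.piecewise V' V i y⟩ : TangentBundle (𝓡 n) M)) x := by
        by_cases hi : i ∈ s
        · simpa [hi] using hV' i
        · simpa [hi] using hV i
      rw [Finset.piecewise_insert, ← ih]
      have := (tensorialAt_covDiffAlong nabla ht v₀ hp j).pointwise (hV' j) (hV j) (h j).symm
      refine this.trans ?_
      have e : s.piecewise V' V j = V j := by simp [hj]
      rw [← e, Function.update_eq_self]
  have := key Finset.univ
  rwa [Finset.piecewise_univ, eq_comm] at this

/-- Frees `covDiff` from the particular extension `FiberBundle.extend` used in its definition. -/
theorem covDiff_eq_of_mdifferentiableAt [T2Space M] {k : ℕ}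
    {t : Π x : M, (Fin k → TangentSpace (𝓡 n) x) → ℂ} (ht : IsSmoothTensor t) {x : M}
    (v : Fin (k + 1) → TangentSpace (𝓡 n) x) {V : Fin k → Π y : M, TangentSpace (𝓡 n) y}
    (hV : ∀ i, MDifferentiableAt (𝓡 n) (𝓡 n).tangent
      (fun y => (⟨y, V i y⟩ : TangentBundle (𝓡 n) M)) x) (h : ∀ i, V i x = v i.succ) :
    covDiff nabla t x v = covDiffAlong nabla t x (v 0) V := by
  rw [covDiff_eq_covDiffAlong]
  exact covDiffAlong_congr nabla ht _ (fun i => FiberBundle.mdifferentiableAt_extend _ _ _) hV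
    (fun i => by simp [h])

variable {nabla}

/-- The covariant derivative of a smooth vector field along another one. -/
def covariantDerivative (hsmooth : CovariantDerivative.ContMDiffCovariantDerivative nabla ∞)
    (X V : VField n M) : VField n M :=
  ⟨fun x => nabla V x (X x), by
    have h1 := (hsmooth.contMDiff.contMDiff (σ := V)
      (V.contMDiff.contMDiffOn.of_le (by simp)))
    rw [contMDiffOn_univ] at h1
    exact h1.clm_bundle_apply X.contMDiff⟩

/-- On global fields the covariant differential becomes an identity in the ring of smooth functions,
which gives smoothness and makes the ideal-theoretic arguments possible. -/
theorem eval_covDiff [T2Space M]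
    (hsmooth : CovariantDerivative.ContMDiffCovariantDerivative nabla ∞) {k : ℕ}
    {t : Π x : M, (Fin k → TangentSpace (𝓡 n) x) → ℂ} (ht : IsSmoothTensor t)
    (V : Fin (k + 1) → VField n M) (x : M) :
    covDiff nabla t x (fun i => V i x) =
      ((V 0).deriv (ht.eval fun i => V i.succ) - ∑ i : Fin k, ht.eval
        (Function.update (fun j => V j.succ) i
          (covariantDerivative hsmooth (V 0) (V i.succ)))).1 x := by
  rw [covDiff_eq_of_mdifferentiableAt nabla ht _ (V := fun i => V i.succ)
    (fun i => (V i.succ).mdifferentiableAt) (fun i => rfl)]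
  have e1 : ((V 0).deriv (ht.eval fun i => V i.succ) - ∑ i : Fin k, ht.eval
        (Function.update (fun j => V j.succ) i
          (covariantDerivative hsmooth (V 0) (V i.succ)))).1 x =
      ((V 0).deriv (ht.eval fun i => V i.succ)).1 x - ∑ i : Fin k, (ht.eval
        (Function.update (fun j => V j.succ) i
          (covariantDerivative hsmooth (V 0) (V i.succ)))).1 x := by
    have := map_sub (evalHom x) ((V 0).deriv (ht.eval fun i => V i.succ)) (∑ i : Fin k, ht.eval
        (Function.update (fun j => V j.succ) i
          (covariantDerivative hsmooth (V 0) (V i.succ))))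
    rw [map_sum] at this
    exact this
  rw [e1, covDiffAlong]
  congr 1
  refine Finset.sum_congr rfl fun i _ => ?_
  change _ = t x _
  congr 1
  ext j
  by_cases h : j = i
  · subst h; simp; rfl
  · simp [h]

/-- The direction slot `0` is linear by linearity of derivatives; the other slots are linear by
tensoriality. -/
theorem isSmoothTensor_covDiff [T2Space M]
    (hsmooth : CovariantDerivative.ContMDiffCovariantDerivative nabla ∞) {k : ℕ}
    {t : Π x : M, (Fin k → TangentSpace (𝓡 n) x) → ℂ} (ht : IsSmoothTensor t) :
    IsSmoothTensor (covDiff nabla t) := by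
  refine ⟨fun x => ?_, fun V => ?_⟩
  · obtain ⟨m, hm⟩ := ht.exists_multilinear x
    have hext (v : TangentSpace (𝓡 n) x) : MDifferentiableAt (𝓡 n) (𝓡 n).tangent
        (fun y => (⟨y, FiberBundle.extend (RSpace n) v y⟩ : TangentBundle (𝓡 n) M)) x :=
      FiberBundle.mdifferentiableAt_extend _ _ _
    have hup (v : Fin (k + 1) → TangentSpace (𝓡 n) x) (i : Fin k)
        (W : Π y : M, TangentSpace (𝓡 n) y) (hW : MDifferentiableAt (𝓡 n) (𝓡 n).tangent
          (fun y => (⟨y, W y⟩ : TangentBundle (𝓡 n) M)) x) :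
        covDiff nabla t x (Function.update v i.succ (W x)) = covDiffAlong nabla t x (v 0)
          (Function.update (fun i => FiberBundle.extend (RSpace n) (v i.succ)) i W) := by
      rw [covDiff_eq_of_mdifferentiableAt nabla ht _ (V := Function.update
        (fun i => FiberBundle.extend (RSpace n) (v i.succ)) i W)]
      · rw [Function.update_of_ne (Fin.succ_ne_zero i).symm]
      · intro j
        by_cases h : j = i
        · subst h; simpa using hW
        · simpa [h] using hext (v j.succ)
      · intro j
        by_cases h : j = i
        · subst h; simp
        · simp [h]
    have hzero (v : Fin (k + 1) → TangentSpace (𝓡 n) x) (w : TangentSpace (𝓡 n) x) :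
        covDiff nabla t x (Function.update v 0 w) = covDiffAlong nabla t x w
          (fun i => FiberBundle.extend (RSpace n) (v i.succ)) := by
      rw [covDiff_eq_covDiffAlong]
      simp
    refine ⟨MultilinearMap.mk' (covDiff nabla t x) ?_ ?_, fun v => rfl⟩
    · intro v i a b
      refine Fin.cases ?_ (fun i => ?_) i
      · simp only [hzero, covDiffAlong, map_add, hm, m.map_update_add, Finset.sum_add_distrib]
        ring
      · have := (tensorialAt_covDiffAlong nabla ht (v 0)
          (fun i => hext (v i.succ)) i).add (hext a) (hext b)
        rw [← hup _ _ _ (hext a), ← hup _ _ _ (hext b),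
          ← hup _ _ _ (mdifferentiableAt_add_section (hext a) (hext b))] at this
        simpa using this
    · intro v i c a
      refine Fin.cases ?_ (fun i => ?_) i
      · simp only [hzero, covDiffAlong, map_smul, hm, m.map_update_smul, ← Finset.smul_sum,
          smul_sub]
      · have := (tensorialAt_covDiffAlong nabla ht (v 0)
          (fun i => hext (v i.succ)) i).smul (f := fun _ => c) mdifferentiableAt_const (hext a)
        rw [← hup _ _ _ (hext a), ← hup _ _ _
          (MDifferentiableAt.smul_section mdifferentiableAt_const (hext a))] at this
        simpa using this
  · simp only [eval_covDiff hsmooth ht V]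
    exact SmoothFun.contMDiff _

theorem isSmoothTensor_iterCovDiff [T2Space M]
    (hsmooth : CovariantDerivative.ContMDiffCovariantDerivative nabla ∞) (f : SmoothFun n M)
    (r : ℕ) : IsSmoothTensor (iterCovDiff nabla f.1 r) := by
  induction r with
  | zero => exact ⟨fun x => ⟨MultilinearMap.constOfIsEmpty ℝ _ (f x), fun v => rfl⟩,
      fun V => f.contMDiff⟩
  | succ r ih => exact isSmoothTensor_covDiff hsmooth ih

end CovariantTensors

/-! ### Trivializations of the cotangent bundle and smooth forms -/

section Cotangent

variable {n : ℕ} {M : Type*} [TopologicalSpace M] [ChartedSpace (RSpace n) M]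
  [IsManifold (𝓡 n) ∞ M]

/-- The hom-bundle trivialization composes on both sides; on the side of the trivial bundle `ℝ` it
is the identity. -/
theorem cot_trivializationAt_apply (x₀ : M) (z : CotBundle n M) :
    trivializationAt (RSpace n →L[ℝ] ℝ) (fun x : M => CotSpace n x) x₀ z =
      (z.1, z.2.comp ((trivializationAt (RSpace n) (TangentSpace (𝓡 n) : M → Type _) x₀).symmL ℝ
        z.1)) := by
  have := hom_trivializationAt_apply (RingHom.id ℝ) (F₁ := RSpace n)
    (E₁ := (TangentSpace (𝓡 n) : M → Type _)) (F₂ := ℝ) (E₂ := fun _ : M => ℝ) x₀ z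
  refine this.trans ?_
  have h := Trivial.continuousLinearMapAt_trivialization ℝ M ℝ z.1
  exact congrArg (Prod.mk z.1) ((congrArg (fun L : ℝ →L[ℝ] ℝ => L.comp (z.2.comp
    ((trivializationAt (RSpace n) (TangentSpace (𝓡 n) : M → Type _) x₀).symmL ℝ z.1))) h).trans
    (ContinuousLinearMap.id_comp _))

theorem isSmoothForm_mvfderiv {f : M → ℝ} (hf : ContMDiff (𝓡 n) 𝓘(ℝ, ℝ) ∞ f) :
    IsSmoothForm (fun x => (mvfderiv (𝓡 n) f x : CotSpace n x)) := by
  intro x₀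
  rw [contMDiffAt_section]
  have h1 := (hf.contMDiffAt (x := x₀)).mfderiv_const (m := ∞) (by simp)
  refine h1.congr_of_eventuallyEq (Filter.Eventually.of_forall fun x => ?_)
  refine (congrArg Prod.snd (cot_trivializationAt_apply x₀
    (⟨x, mvfderiv (𝓡 n) f x⟩ : CotBundle n M))).trans ?_
  simp only [inTangentCoordinates, ContinuousLinearMap.inCoordinates,
    TangentBundle.continuousLinearMapAt_model_space]
  rfl

/-- The source `N` is arbitrary so that the lemma serves both for a 1-form (`N = M`) and for the
tautological pairing on `T*M` (`w = id`). -/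
theorem contMDiffAt_cot_apply {N : Type*} {EN HN : Type*} [NormedAddCommGroup EN]
    [NormedSpace ℝ EN] [TopologicalSpace HN] {J : ModelWithCorners ℝ EN HN} [TopologicalSpace N]
    [ChartedSpace HN N] {w : N → CotBundle n M} {p : N} (hw : ContMDiffAt J (cotModel n) ∞ w p)
    (X : VField n M) : ContMDiffAt J 𝓘(ℝ, ℝ) ∞ (fun q => (w q).2 (X (w q).1)) p := by
  have hb : ContMDiffAt J (𝓡 n) ∞ (fun q => (w q).1) p :=
    (contMDiff_proj (fun x : M => CotSpace n x)).contMDiffAt.comp p hw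
  have h1 := ContMDiffAt.clm_bundle_apply (F₁ := RSpace n) (F₂ := ℝ)
    (E₁ := (TangentSpace (𝓡 n) : M → Type _)) (E₂ := fun _ : M => ℝ) (b := fun q => (w q).1)
    (ϕ := fun q => (w q).2) (v := fun q => X (w q).1) hw
    (X.contMDiff.contMDiffAt.comp p hb)
  exact (contMDiffAt_totalSpace.1 h1).2

end Cotangent

/-! ### Contraction and its independence of the frame -/

section Contraction

variable {n : ℕ} {M : Type*} [TopologicalSpace M] [ChartedSpace (RSpace n) M]

theorem coordCovec_coordVec (x : M) (i j : Fin n) :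
    coordCovec x i (coordVec x j) = if i = j then 1 else 0 := by
  change (EuclideanSpace.single j (1 : ℝ) : RSpace n) i = _
  simp

/-- The contraction may be computed in any pair of dual bases. -/
theorem contract_eq_of_dual {r : ℕ} {x : M}
    (Φ : MultilinearMap ℝ (fun _ : Fin r => CotSpace n x) ℂ)
    (m : MultilinearMap ℝ (fun _ : Fin r => TangentSpace (𝓡 n) x) ℂ)
    {α : Fin n → CotSpace n x} {e : Fin n → TangentSpace (𝓡 n) x}
    (h : ∀ i j, α i (e j) = if i = j then 1 else 0) :
    contract x Φ m = ∑ J : Fin r → Fin n, Φ (fun i => α (J i)) * m (fun i => e (J i)) := by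
  have h1 := (sum_smul_of_dual h).2
  have h2 := (sum_smul_of_dual (coordCovec_coordVec (n := n) x)).1
  have e1 (J : Fin r → Fin n) : Φ (fun i => coordCovec x (J i)) =
      ∑ K : Fin r → Fin n, (∏ i, coordCovec x (J i) (e (K i))) • Φ (fun i => α (K i)) := by
    have : (fun i => coordCovec x (J i)) =
        fun i => ∑ k, coordCovec x (J i) (e k) • α k := funext fun i => h1 _
    rw [this, Φ.map_sum]
    exact Finset.sum_congr rfl fun K _ => Φ.map_smul_univ _ _
  have e2 (K : Fin r → Fin n) : m (fun i => e (K i)) =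
      ∑ J : Fin r → Fin n, (∏ i, coordCovec x (J i) (e (K i))) • m (fun i => coordVec x (J i)) := by
    have : (fun i => e (K i)) =
        fun i => ∑ j, coordCovec x j (e (K i)) • coordVec x j := funext fun i => h2 _
    rw [this, m.map_sum]
    exact Finset.sum_congr rfl fun J _ => m.map_smul_univ _ _
  simp only [contract, e1, e2, Finset.sum_mul, Finset.mul_sum]
  rw [Finset.sum_comm]
  refine Finset.sum_congr rfl fun K _ => Finset.sum_congr rfl fun J _ => ?_
  rw [smul_mul_assoc, mul_smul_comm]

variable [IsManifold (𝓡 n) ∞ M] [T2Space M]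

/-- The bases in `contract` come from the preferred chart at each point and need not vary
continuously. Near `x₀` they are exchanged for a smooth dual frame. -/
theorem contMDiff_contract {r : ℕ} (Φ : symTensors n M r)
    {t : Π x : M, (Fin r → TangentSpace (𝓡 n) x) → ℂ} (ht : IsSmoothTensor t) :
    ContMDiff (𝓡 n) 𝓘(ℝ, ℂ) ∞ (fun x => contract x (Φ.1 x) (t x)) := by
  intro x₀
  obtain ⟨ξ, E, hξ, h⟩ := exists_coord_frame (n := n) x₀
  have h1 : ContMDiff (𝓡 n) 𝓘(ℝ, ℂ) ∞ (fun y => ∑ J : Fin r → Fin n,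
      Φ.1 y (fun i => mvfderiv (𝓡 n) (ξ (J i)) y) * t y (fun i => E (J i) y)) := by
    refine contMDiff_finsetSum fun J _ => ?_
    exact (contDiff_mul (𝕜 := ℝ) (𝔸 := ℂ)).contMDiff.comp
      ((Φ.2.2 (fun i y => mvfderiv (𝓡 n) (ξ (J i)) y)
        fun i => isSmoothForm_mvfderiv (hξ _)).prodMk_space (ht.contMDiff fun i => E (J i)))
  refine h1.contMDiffAt.congr_of_eventuallyEq ?_
  filter_upwards [h] with y hy
  obtain ⟨m, hm⟩ := ht.exists_multilinear y
  have h2 : t y = m := funext hm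
  rw [h2]
  exact contract_eq_of_dual _ m hy

end Contraction

/-! ### Iterated covariant differentials modulo powers of `𝔪_x` -/

section Order

variable {n : ℕ} {M : Type*} [TopologicalSpace M] [ChartedSpace (RSpace n) M]
  [IsManifold (𝓡 n) ∞ M] [T2Space M]
  {nabla : CovariantDerivative (𝓡 n) (RSpace n) (TangentSpace (𝓡 n) : M → Type _)}
  (hsmooth : CovariantDerivative.ContMDiffCovariantDerivative nabla ∞)

/-- The iterated covariant differential of a smooth function evaluated on vector fields. -/
def iterEval (f : SmoothFun n M) (r : ℕ) (V : Fin r → VField n M) : SmoothFun n M :=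
  (isSmoothTensor_iterCovDiff hsmooth f r).eval V

theorem iterEval_succ (f : SmoothFun n M) (r : ℕ) (V : Fin (r + 1) → VField n M) :
    iterEval hsmooth f (r + 1) V = (V 0).deriv (iterEval hsmooth f r fun i => V i.succ) -
      ∑ i : Fin r, iterEval hsmooth f r (Function.update (fun j => V j.succ) i
        (covariantDerivative hsmooth (V 0) (V i.succ))) :=
  SmoothFun.ext fun x => eval_covDiff hsmooth (isSmoothTensor_iterCovDiff hsmooth f r) V x

theorem iterEval_add (f g : SmoothFun n M) (r : ℕ) (V : Fin r → VField n M) :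
    iterEval hsmooth (f + g) r V = iterEval hsmooth f r V + iterEval hsmooth g r V := by
  induction r with
  | zero => rfl
  | succ r ih =>
    simp only [iterEval_succ, ih, VField.deriv_add, Finset.sum_add_distrib]
    ring

theorem iterEval_smul (c : ℂ) (f : SmoothFun n M) (r : ℕ) (V : Fin r → VField n M) :
    iterEval hsmooth (c • f) r V = c • iterEval hsmooth f r V := by
  induction r with
  | zero => rfl
  | succ r ih => simp only [iterEval_succ, ih, VField.deriv_smul, smul_sub, Finset.smul_sum]

/-- Each step costs at most one power of `𝔪_x`; the connection terms involve one derivative less and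
so lie even deeper. -/
theorem iterEval_mem_pow (x : M) (r : ℕ) : ∀ (s : ℕ) (f : SmoothFun n M),
    f ∈ (vanishingIdeal x : Ideal (SmoothFun n M)) ^ (s + r) → ∀ V : Fin r → VField n M,
      iterEval hsmooth f r V ∈ (vanishingIdeal x : Ideal (SmoothFun n M)) ^ s := by
  induction r with
  | zero => intro s f hf V; exact hf
  | succ r ih =>
    intro s f hf V
    rw [show s + (r + 1) = (s + 1) + r by ring] at hf
    rw [iterEval_succ]
    refine sub_mem (VField.deriv_mem_pow _ _ _ _ (ih (s + 1) f hf _))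
      (sum_mem fun i _ => Ideal.pow_le_pow_right (Nat.le_succ s) (ih (s + 1) f hf _))

/-- Modulo `𝔪_x ^ (s + 1)` only the terms where every derivative lowers the exponent survive,
producing `(s + r) ⋯ (s + 1)`. Only `s = 0` is used later, but the induction needs the inner terms
to one more power, hence general `s`. -/
theorem iterEval_pow_sub_mem (x : M) {f : SmoothFun n M} (hf : f ∈ vanishingIdeal x) (r : ℕ) :
    ∀ (s : ℕ) (V : Fin r → VField n M), iterEval hsmooth (f ^ (s + r)) r V -
      ((s + r).descFactorial r : ℂ) • (f ^ s * ∏ i, (V i).deriv f) ∈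
        (vanishingIdeal x : Ideal (SmoothFun n M)) ^ (s + 1) := by
  induction r with
  | zero =>
    intro s V
    have : iterEval hsmooth (f ^ (s + 0)) 0 V = f ^ s := rfl
    rw [this]
    simp
  | succ r ih =>
    intro s V
    rw [show s + (r + 1) = (s + 1) + r by ring, iterEval_succ]
    set g := iterEval hsmooth (f ^ (s + 1 + r)) r fun i => V i.succ with hg
    set p := ∏ i : Fin r, (V i.succ).deriv f with hp
    have h1 := VField.deriv_mem_pow (V 0) x (s + 1) _ (ih (s + 1) fun i => V i.succ)
    rw [VField.deriv_sub, VField.deriv_smul, VField.deriv_mul, VField.deriv_pow] at h1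
    have hfp : f ^ (s + 1 + r) ∈ (vanishingIdeal x : Ideal (SmoothFun n M)) ^ (s + 1 + r) :=
      Ideal.pow_mem_pow hf _
    have h2 := sum_mem (t := Finset.univ) (fun (i : Fin r) _ =>
      iterEval_mem_pow hsmooth x r (s + 1) _ hfp (Function.update (fun j => V j.succ) i
        (covariantDerivative hsmooth (V 0) (V i.succ))))
    -- The derivative falling on the product `p` leaves `f ^ (s + 1)` intact.
    have h3 : ((s + 1 + r).descFactorial r : ℂ) • (f ^ (s + 1) * (V 0).deriv p) ∈
        (vanishingIdeal x : Ideal (SmoothFun n M)) ^ (s + 1) := by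
      rw [Algebra.smul_def]
      exact Ideal.mul_mem_left _ _ (Ideal.mul_mem_right _ _ (Ideal.pow_mem_pow hf _))
    have hc : ((s + 1 + r).descFactorial (r + 1) : ℂ) =
        ((s + 1 + r).descFactorial r : ℂ) * ((s + 1 : ℕ) : ℂ) := by
      rw [Nat.descFactorial_succ]
      push_cast
      rw [show s + 1 + r - r = s + 1 by omega]
      push_cast
      ring
    have h4 := sub_mem (add_mem h1 h3) h2
    convert h4 using 1
    rw [Fin.prod_univ_succ, hc, ← hp, ← hg]
    simp only [Algebra.smul_def, map_mul, map_natCast]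
    ring

end Order

/-! ### Values of iterated covariant differentials at a point -/

section Order

variable {n : ℕ} {M : Type*} [TopologicalSpace M] [ChartedSpace (RSpace n) M]
  [IsManifold (𝓡 n) ∞ M] [T2Space M]
  {nabla : CovariantDerivative (𝓡 n) (RSpace n) (TangentSpace (𝓡 n) : M → Type _)}

/-- Extending the vectors to global fields turns the pointwise claim into one about `iterEval`. -/
theorem iterCovDiff_eq_zero
    (hsmooth : CovariantDerivative.ContMDiffCovariantDerivative nabla ∞)
    {x : M} {r : ℕ} {f : SmoothFun n M}
    (hf : f ∈ (vanishingIdeal x : Ideal (SmoothFun n M)) ^ (r + 1)) {k : ℕ} (hk : k ≤ r)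
    (v : Fin k → TangentSpace (𝓡 n) x) : iterCovDiff nabla f.1 k x v = 0 := by
  choose V hV using fun i => exists_vField_eq (n := n) x (v i)
  have h1 := iterEval_mem_pow hsmooth x k 1 f (Ideal.pow_le_pow_right (by omega) hf) V
  rw [pow_one] at h1
  have h2 : iterCovDiff nabla f.1 k x (fun i => V i x) = 0 := h1
  simpa only [hV] using h2

theorem iterCovDiff_pow
    (hsmooth : CovariantDerivative.ContMDiffCovariantDerivative nabla ∞)
    {x : M} {f : SmoothFun n M} (hf : f ∈ vanishingIdeal x) (r : ℕ)
    (v : Fin r → TangentSpace (𝓡 n) x) :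
    iterCovDiff nabla (f ^ r).1 r x v = r.factorial * ∏ i, mvfderiv (𝓡 n) f.1 x (v i) := by
  choose V hV using fun i => exists_vField_eq (n := n) x (v i)
  have h1 := iterEval_pow_sub_mem hsmooth x hf r 0 V
  rw [zero_add, pow_one, vanishingIdeal_eq_ker, RingHom.mem_ker, zero_add, pow_zero, one_mul] at h1
  have h2 : evalHom x (iterEval hsmooth (f ^ r) r V) =
      (r.descFactorial r : ℂ) * ∏ i, evalHom x ((V i).deriv f) := by
    have := sub_eq_zero.1 ((map_sub (evalHom x) _ _).symm.trans h1)
    rw [this, map_smul, map_prod]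
    rfl
  rw [Nat.descFactorial_self] at h2
  have h3 : iterCovDiff nabla (f ^ r).1 r x (fun i => V i x) =
    r.factorial * ∏ i, mvfderiv (𝓡 n) f.1 x (V i x) := h2
  simpa only [hV] using h3

theorem symCovDiff_eq_zero
    (hsmooth : CovariantDerivative.ContMDiffCovariantDerivative nabla ∞)
    {x : M} {r : ℕ} {f : SmoothFun n M}
    (hf : f ∈ (vanishingIdeal x : Ideal (SmoothFun n M)) ^ (r + 1)) {k : ℕ} (hk : k ≤ r)
    (v : Fin k → TangentSpace (𝓡 n) x) : symCovDiff nabla f.1 k x v = 0 := by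
  simp [symCovDiff, iterCovDiff_eq_zero hsmooth hf hk]

theorem symCovDiff_pow
    (hsmooth : CovariantDerivative.ContMDiffCovariantDerivative nabla ∞)
    {x : M} {f : SmoothFun n M} (hf : f ∈ vanishingIdeal x) (r : ℕ)
    (v : Fin r → TangentSpace (𝓡 n) x) :
    symCovDiff nabla (f ^ r).1 r x v = r.factorial * ∏ i, mvfderiv (𝓡 n) f.1 x (v i) := by
  have h (σ : Equiv.Perm (Fin r)) : ∏ i, mvfderiv (𝓡 n) f.1 x (v (σ i)) =
      ∏ i, mvfderiv (𝓡 n) f.1 x (v i) := Equiv.prod_comp σ fun i => mvfderiv (𝓡 n) f.1 x (v i)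
  have h0 : (r.factorial : ℂ) ≠ 0 := by exact_mod_cast r.factorial_ne_zero
  simp only [symCovDiff, iterCovDiff_pow hsmooth hf, h, Finset.sum_const, Finset.card_univ,
    Fintype.card_perm, Fintype.card_fin, nsmul_eq_mul]
  field_simp

theorem iterCovDiff_add
    (hsmooth : CovariantDerivative.ContMDiffCovariantDerivative nabla ∞)
    (f g : SmoothFun n M) (r : ℕ) (x : M)
    (v : Fin r → TangentSpace (𝓡 n) x) :
    iterCovDiff nabla (f + g).1 r x v = iterCovDiff nabla f.1 r x v +
      iterCovDiff nabla g.1 r x v := by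
  choose V hV using fun i => exists_vField_eq (n := n) x (v i)
  have h1 := congrArg (evalHom x) (iterEval_add hsmooth f g r V)
  have h2 : iterCovDiff nabla (f + g).1 r x (fun i => V i x) =
    iterCovDiff nabla f.1 r x (fun i => V i x) + iterCovDiff nabla g.1 r x (fun i => V i x) := h1
  simpa only [hV] using h2

theorem iterCovDiff_smul
    (hsmooth : CovariantDerivative.ContMDiffCovariantDerivative nabla ∞)
    (c : ℂ) (f : SmoothFun n M) (r : ℕ) (x : M)
    (v : Fin r → TangentSpace (𝓡 n) x) :
    iterCovDiff nabla (c • f).1 r x v = c * iterCovDiff nabla f.1 r x v := by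
  choose V hV using fun i => exists_vField_eq (n := n) x (v i)
  have h1 := congrArg (evalHom x) (iterEval_smul hsmooth c f r V)
  have h2 : iterCovDiff nabla (c • f).1 r x (fun i => V i x) =
    c * iterCovDiff nabla f.1 r x (fun i => V i x) := h1
  simpa only [hV] using h2

theorem isSmoothTensor_symCovDiff
    (hsmooth : CovariantDerivative.ContMDiffCovariantDerivative nabla ∞)
    (f : SmoothFun n M) (r : ℕ) :
    IsSmoothTensor (symCovDiff nabla f.1 r) := by
  have ht := isSmoothTensor_iterCovDiff hsmooth f r
  refine ⟨fun x => ?_, fun V => ?_⟩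
  · obtain ⟨m, hm⟩ := ht.exists_multilinear x
    refine ⟨(r.factorial : ℂ)⁻¹ • ∑ σ : Equiv.Perm (Fin r), m.domDomCongr σ, fun v => ?_⟩
    simp [symCovDiff, hm]
  · have h1 : ContMDiff (𝓡 n) 𝓘(ℝ, ℂ) ∞ (fun x => ∑ σ : Equiv.Perm (Fin r),
        iterCovDiff nabla f.1 r x (fun i => V (σ i) x)) :=
      contMDiff_finsetSum fun σ _ => ht.contMDiff fun i => V (σ i)
    exact (contDiff_const_smul (𝕜 := ℝ) ((r.factorial : ℂ)⁻¹)).contMDiff.comp h1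

end Order

/-! ### Powers of the vanishing ideal and polarization -/

section Ideals

variable {n : ℕ} {M : Type*} [TopologicalSpace M] [ChartedSpace (RSpace n) M]

theorem prod_mem_pow_card {A : Type*} [CommRing A] {I : Ideal A} {s : ℕ} {g : Fin s → A}
    (hg : ∀ i, g i ∈ I) : ∏ i, g i ∈ I ^ s := by
  induction s with
  | zero => simp
  | succ s ih =>
    rw [Fin.prod_univ_succ, pow_succ']
    exact Ideal.mul_mem_mul (hg 0) (ih fun i => hg i.succ)

/-- Telescoping: `g₀ G - h₀ H = (g₀ - h₀) G + h₀ (G - H)`, and both terms gain one power of `I`. -/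
theorem prod_sub_prod_mem {A : Type*} [CommRing A] {I : Ideal A} {s : ℕ} {g h : Fin s → A}
    (hg : ∀ i, g i ∈ I) (hh : ∀ i, h i ∈ I) (hgh : ∀ i, g i - h i ∈ I ^ 2) :
    ∏ i, g i - ∏ i, h i ∈ I ^ (s + 1) := by
  induction s with
  | zero => simp
  | succ s ih =>
    rw [Fin.prod_univ_succ, Fin.prod_univ_succ]
    have h1 := Ideal.mul_mem_mul (hgh 0) (prod_mem_pow_card fun i => hg (Fin.succ i))
    have h2 := Ideal.mul_mem_mul (hh 0) (ih (fun i => hg i.succ) (fun i => hh i.succ)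
      fun i => hgh i.succ)
    rw [← pow_add] at h1
    rw [← pow_succ'] at h2
    rw [show 2 + s = s + 1 + 1 by ring] at h1
    convert add_mem h1 h2 using 1
    ring

/-- A subspace containing `𝔪_x ^ (s + 1)` and the `s`-fold products of elements of `𝔪_x`
contains `𝔪_x ^ s`. -/
theorem vanishingIdeal_pow_le {x : M} {s : ℕ} : ∀ {Q : Submodule ℂ (SmoothFun n M)},
    (∀ f ∈ (vanishingIdeal x : Ideal (SmoothFun n M)) ^ (s + 1), f ∈ Q) →
    (∀ g : Fin s → SmoothFun n M, (∀ i, g i ∈ vanishingIdeal x) → ∏ i, g i ∈ Q) →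
    ∀ f ∈ (vanishingIdeal x : Ideal (SmoothFun n M)) ^ s, f ∈ Q := by
  induction s with
  | zero =>
    intro Q h1 h2 f _
    have h3 : f - f x • (1 : SmoothFun n M) ∈ vanishingIdeal x := by
      rw [vanishingIdeal_eq_ker, RingHom.mem_ker, map_sub, map_smul, map_one]
      simp [evalHom_apply]
    have h4 := h2 Fin.elim0 (fun i => i.elim0)
    rw [Fin.prod_univ_zero] at h4
    have := Q.add_mem (h1 _ (by simpa using h3)) (Q.smul_mem (f x) h4)
    simpa using this
  | succ s ih =>
    intro Q h1 h2 f hf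
    rw [pow_succ'] at hf
    refine Submodule.mul_induction_on hf (fun a ha b hb => ?_) fun a b => Q.add_mem
    -- With the first factor `a` fixed, the functions `b` with `a * b ∈ Q` form a subspace
    -- satisfying the hypotheses one power lower.
    have := ih (Q := Q.comap (LinearMap.mulLeft ℂ a)) (fun f hf => ?_) (fun g hg => ?_) b hb
    · exact this
    · refine h1 _ ?_
      rw [pow_succ']
      exact Ideal.mul_mem_mul ha hf
    · have h3 := h2 (Fin.cons a g) (Fin.cases ha hg)
      rw [Fin.prod_univ_succ] at h3
      simpa using h3

/-- A linear functional that kills `𝔪_x ^ (s + 1)` and the `s`-th powers of elements of `𝔪_x`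
kills `𝔪_x ^ s`. -/
theorem eq_zero_of_pow_eq_zero {x : M} {s : ℕ} (L : SmoothFun n M →ₗ[ℂ] ℂ)
    (h1 : ∀ f ∈ (vanishingIdeal x : Ideal (SmoothFun n M)) ^ (s + 1), L f = 0)
    (h2 : ∀ f ∈ (vanishingIdeal x : Ideal (SmoothFun n M)), L (f ^ s) = 0) :
    ∀ f ∈ (vanishingIdeal x : Ideal (SmoothFun n M)) ^ s, L f = 0 := by
  let I : Submodule ℂ (SmoothFun n M) := (vanishingIdeal x).restrictScalars ℂ
  -- The form `g ↦ L (∏ g i)` on `𝔪_x` is symmetric and vanishes on the diagonal, so polarization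
  -- kills it.
  let m : MultilinearMap ℂ (fun _ : Fin s => I) ℂ :=
    L.compMultilinearMap ((MultilinearMap.mkPiAlgebra ℂ (Fin s) (SmoothFun n M)).compLinearMap
      fun _ => I.subtype)
  have hm : ∀ g, m g = L (∏ i, (g i : SmoothFun n M)) := fun g => by simp [m]
  have hm0 : m = 0 := eq_zero_of_diagonal_eq_zero m
    (fun σ a => by
      rw [hm, hm]
      exact congrArg L (Equiv.prod_comp σ fun i => (a i : SmoothFun n M)))
    (fun a => by
      rw [hm, Finset.prod_const, Finset.card_univ, Fintype.card_fin]
      exact h2 _ a.2)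
  refine vanishingIdeal_pow_le (Q := LinearMap.ker L) h1 fun g hg => ?_
  rw [LinearMap.mem_ker]
  have := hm fun i => ⟨g i, hg i⟩
  rw [hm0] at this
  simpa using this.symm

end Ideals

/-- The argument of `P` depends on the evaluation point only through the constants `g i y`.
Expanding the product over subsets and using linearity moves them out of `P`. -/
theorem contMDiff_apply_prod_sub {n : ℕ} {M : Type*} [TopologicalSpace M]
    [ChartedSpace (RSpace n) M] {s : ℕ} (P : Module.End ℂ (SmoothFun n M))
    (g : Fin s → SmoothFun n M) :
    ContMDiff (𝓡 n) 𝓘(ℝ, ℂ) ∞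
      (fun y => P (∏ i, (g i - algebraMap ℂ _ (g i y))) y) := by
  classical
  have h (y : M) : P (∏ i, (g i - algebraMap ℂ _ (g i y))) y =
      (∑ t ∈ Finset.univ.powerset, (∏ i ∈ Finset.univ \ t, -g i) * P (∏ i ∈ t, g i)) y := by
    simp only [sub_eq_add_neg, Finset.prod_add, map_sum]
    rw [← evalHom_apply, ← evalHom_apply, map_sum, map_sum]
    refine Finset.sum_congr rfl fun t _ => ?_
    have e : ∏ i ∈ Finset.univ \ t, -algebraMap ℂ (SmoothFun n M) (g i y) =
        algebraMap ℂ _ (∏ i ∈ Finset.univ \ t, -g i y) := by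
      rw [map_prod]
      exact Finset.prod_congr rfl fun i _ => (map_neg _ _).symm
    rw [e, mul_comm, ← Algebra.smul_def, map_smul, map_smul, map_mul (evalHom y),
      map_prod (evalHom y), smul_eq_mul]
    congr 1
  simp only [h]
  exact SmoothFun.contMDiff _

/-! ### The principal symbol of a differential operator -/

section Symbols

variable {n : ℕ} {M : Type*} [TopologicalSpace M] [ChartedSpace (RSpace n) M]
  [IsManifold (𝓡 n) ∞ M] [T2Space M]

/-- The differential at `x` in the direction `v`. -/
def diffAt (x : M) (v : TangentSpace (𝓡 n) x) : SmoothFun n M →ₗ[ℂ] ℂ where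
  toFun f := mvfderiv (𝓡 n) f.1 x v
  map_add' f g := by
    obtain ⟨X, rfl⟩ := exists_vField_eq x v
    exact congrArg (evalHom x) (X.deriv_add f g)
  map_smul' c f := by
    obtain ⟨X, rfl⟩ := exists_vField_eq x v
    exact congrArg (evalHom x) (X.deriv_smul c f)

theorem sub_mem_vanishingIdeal_sq {x : M} {f g : SmoothFun n M} (hf : f ∈ vanishingIdeal x)
    (hg : g ∈ vanishingIdeal x) (h : ∀ v, diffAt x v f = diffAt x v g) :
    f - g ∈ (vanishingIdeal x : Ideal (SmoothFun n M)) ^ 2 := by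
  refine mem_vanishingIdeal_sq (sub_mem hf hg) ?_
  ext v
  have : diffAt x v (f - g) = 0 := by rw [map_sub, h v, sub_self]
  exact this

/-- A linear choice of functions vanishing at `x` with prescribed differential at `x`. -/
theorem exists_linearMap_diffAt (x : M) : ∃ l : CotSpace n x →ₗ[ℝ] SmoothFun n M,
    ∀ α, l α ∈ vanishingIdeal x ∧ ∀ v, diffAt x v (l α) = (α v : ℝ) := by
  obtain ⟨ξ, E, hξ, h⟩ := exists_coord_frame (n := n) x
  have hx := h.self_of_nhds
  let u : Fin n → SmoothFun n M := fun j => ofRealFun (ξ j) (hξ j) - algebraMap ℂ _ (ξ j x : ℂ)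
  have hu : ∀ j, u j ∈ vanishingIdeal x := fun j => by
    change (ξ j x : ℂ) - (ξ j x : ℂ) = 0
    simp
  have hdu : ∀ j v, diffAt x v (u j) = (mvfderiv (𝓡 n) (ξ j) x v : ℝ) := fun j v => by
    simp only [u, map_sub]
    have h1 : diffAt x v (algebraMap ℂ (SmoothFun n M) (ξ j x : ℂ)) = 0 := by
      obtain ⟨X, rfl⟩ := exists_vField_eq x v
      exact congrArg (evalHom x) (X.deriv_algebraMap _)
    rw [h1, sub_zero]
    exact mvfderiv_ofReal ((hξ j).mdifferentiableAt (by simp)) v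
  refine ⟨{ toFun := fun α => ∑ j, ((α (E j x) : ℝ) : ℂ) • u j
            map_add' := fun α β => ?_
            map_smul' := fun c α => ?_ }, fun α => ⟨?_, fun v => ?_⟩⟩
  · simp [add_smul, Finset.sum_add_distrib]
  · simp only [smul_apply, smul_eq_mul, RingHom.id_apply, Finset.smul_sum]
    refine Finset.sum_congr rfl fun j _ => ?_
    rw [Complex.ofReal_mul, mul_smul]
    rfl
  · change ∑ j, ((α (E j x) : ℝ) : ℂ) • u j ∈ vanishingIdeal x
    refine sum_mem fun j _ => ?_
    rw [Algebra.smul_def]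
    exact Ideal.mul_mem_left _ _ (hu j)
  · simp only [LinearMap.coe_mk, AddHom.coe_mk, map_sum, map_smul, hdu]
    conv_rhs => rw [(sum_smul_of_dual hx).2 α]
    simp

/-- A linear choice of functions vanishing at `x` with prescribed differential at `x`. -/
def primitiveAt (x : M) : CotSpace n x →ₗ[ℝ] SmoothFun n M :=
  Classical.choose (exists_linearMap_diffAt x)

theorem primitiveAt_mem (x : M) (α : CotSpace n x) : primitiveAt x α ∈ vanishingIdeal x :=
  (Classical.choose_spec (exists_linearMap_diffAt x) α).1

theorem diffAt_primitiveAt (x : M) (α : CotSpace n x) (v : TangentSpace (𝓡 n) x) :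
    diffAt x v (primitiveAt x α) = (α v : ℝ) :=
  (Classical.choose_spec (exists_linearMap_diffAt x) α).2 v

variable {s : ℕ} {P : Module.End ℂ (SmoothFun n M)}

/-- Functions in `𝔪_x` with equal differentials differ by an element of `𝔪_x ^ 2`, so the two
products differ by an element of `𝔪_x ^ (s + 1)`. -/
theorem apply_prod_eq_of_diffAt_eq (hP : IsDiffOpOfOrder s P) {x : M}
    {g h : Fin s → SmoothFun n M} (hg : ∀ i, g i ∈ vanishingIdeal x)
    (hh : ∀ i, h i ∈ vanishingIdeal x) (hgh : ∀ i v, diffAt x v (g i) = diffAt x v (h i)) :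
    P (∏ i, g i) x = P (∏ i, h i) x := by
  have h1 := hP x _ (prod_sub_prod_mem hg hh
    fun i => sub_mem_vanishingIdeal_sq (hg i) (hh i) (hgh i))
  rw [map_sub] at h1
  exact sub_eq_zero.1 h1

/-- The value at `x` of `P` on products of functions with given differentials. -/
def symbolAt (P : Module.End ℂ (SmoothFun n M)) (s : ℕ) (x : M) :
    MultilinearMap ℝ (fun _ : Fin s => CotSpace n x) ℂ :=
  (((evalHom x).toLinearMap ∘ₗ P).restrictScalars ℝ).compMultilinearMap
    ((MultilinearMap.mkPiAlgebra ℝ (Fin s) (SmoothFun n M)).compLinearMap fun _ => primitiveAt x)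

theorem symbolAt_apply (x : M) (a : Fin s → CotSpace n x) :
    symbolAt P s x a = P (∏ i, primitiveAt x (a i)) x := by
  simp [symbolAt, evalHom_apply]

/-- The principal symbol of a differential operator of order `s`. -/
def symbol (hP : IsDiffOpOfOrder s P) : symTensors n M s :=
  ⟨fun x => symbolAt P s x, fun x σ a => by
    rw [symbolAt_apply, symbolAt_apply]
    rw [Equiv.prod_comp σ fun i => primitiveAt x (a i)], fun a ha x₀ => by
    obtain ⟨ξ, E, hξ, h⟩ := exists_coord_frame (n := n) x₀
    -- The functions `primitiveAt y` are chosen separately at each `y`. Since only differentials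
    -- matter, they may be replaced by `ξ j - ξ j y`, whose dependence on `y` is explicit.
    have h1 : ContMDiff (𝓡 n) 𝓘(ℝ, ℂ) ∞ (fun y => ∑ J : Fin s → Fin n,
        ((∏ i, a i y (E (J i) y) : ℝ) : ℂ) * P (∏ i, (ofRealFun (ξ (J i)) (hξ (J i)) -
          algebraMap ℂ _ (ofRealFun (ξ (J i)) (hξ (J i)) y))) y) := by
      refine contMDiff_finsetSum fun J _ => ?_
      refine (contDiff_mul (𝕜 := ℝ) (𝔸 := ℂ)).contMDiff.comp
        (ContMDiff.prodMk_space ?_ (contMDiff_apply_prod_sub P _))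
      have hprod : ContMDiff (𝓡 n) 𝓘(ℝ, ℝ) ∞ (fun y => ∏ i, a i y (E (J i) y)) :=
        contMDiff_finsetProd fun i _ y => contMDiffAt_cot_apply (ha i y) (E (J i))
      exact Complex.ofRealCLM.contDiff.contMDiff.comp hprod
    refine h1.contMDiffAt.congr_of_eventuallyEq ?_
    filter_upwards [h] with y hy
    have h2 := (sum_smul_of_dual hy).2
    have h3 : (fun i => a i y) = fun i => ∑ j, a i y (E j y) • (mvfderiv (𝓡 n) (ξ j) y :
        CotSpace n y) := funext fun i => h2 (a i y)
    rw [h3, (symbolAt P s y).map_sum]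
    refine Finset.sum_congr rfl fun J _ => ?_
    rw [(symbolAt P s y).map_smul_univ, symbolAt_apply, Complex.real_smul]
    congr 1
    refine apply_prod_eq_of_diffAt_eq hP (fun i => primitiveAt_mem _ _) (fun i => ?_)
      fun i v => ?_
    · change (ξ (J i) y : ℂ) - (ξ (J i) y : ℂ) = 0
      simp
    · rw [diffAt_primitiveAt, map_sub]
      have h4 (c : ℂ) : diffAt y v (algebraMap ℂ (SmoothFun n M) c) = 0 := by
        obtain ⟨X, rfl⟩ := exists_vField_eq y v
        exact congrArg (evalHom y) (X.deriv_algebraMap _)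
      rw [h4, sub_zero]
      exact (mvfderiv_ofReal ((hξ _).mdifferentiableAt (by simp)) v).symm⟩

/-- A differential operator of order `s` on the `s`-th power of a function vanishing at `x`. -/
theorem apply_pow_eq_symbol (hP : IsDiffOpOfOrder s P) {x : M} {f : SmoothFun n M}
    (hf : f ∈ vanishingIdeal x) :
    P (f ^ s) x = contract x ((symbol hP).1 x)
      fun v => ∏ i, mvfderiv (𝓡 n) f.1 x (v i) := by
  -- As `f` is complex, its differential need not be a real covector; `h` is a complex combination
  -- of real primitives with the same differential.
  let h : SmoothFun n M := ∑ j, diffAt x (coordVec x j) f • primitiveAt x (coordCovec x j)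
  have hh : h ∈ vanishingIdeal x := sum_mem fun j _ => by
    rw [Algebra.smul_def]
    exact Ideal.mul_mem_left _ _ (primitiveAt_mem _ _)
  have hd : ∀ v, diffAt x v f = diffAt x v h := fun v => by
    have h1 := (sum_smul_of_dual (coordCovec_coordVec (n := n) x)).1 v
    simp only [h, map_sum, map_smul, diffAt_primitiveAt]
    have h2 : diffAt x v f = mvfderiv (𝓡 n) f.1 x v := rfl
    rw [h2]
    conv_lhs => rw [h1]
    rw [map_sum]
    refine Finset.sum_congr rfl fun j _ => ?_
    rw [map_smul, Complex.real_smul, smul_eq_mul, mul_comm]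
    rfl
  have h1 := apply_prod_eq_of_diffAt_eq hP (g := fun _ => f) (h := fun _ => h) (fun _ => hf)
    (fun _ => hh) (fun _ => hd)
  rw [Finset.prod_const, Finset.card_univ, Fintype.card_fin] at h1
  rw [h1]
  have h2 : ∏ _i : Fin s, h = ∑ J : Fin s → Fin n, (∏ i, diffAt x (coordVec x (J i)) f) •
      ∏ i, primitiveAt x (coordCovec x (J i)) := by
    simp only [h]
    rw [Finset.prod_univ_sum, Fintype.piFinset_univ]
    refine Finset.sum_congr rfl fun J _ => ?_
    simp only [Algebra.smul_def, map_prod, Finset.prod_mul_distrib]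
  rw [h2, map_sum, ← evalHom_apply, map_sum, contract]
  refine Finset.sum_congr rfl fun J _ => ?_
  rw [map_smul, map_smul, smul_eq_mul, mul_comm]
  congr 1

end Symbols

theorem contract_prod_ofReal {n r : ℕ} {M : Type*} [TopologicalSpace M]
    [ChartedSpace (RSpace n) M] (x : M)
    (φ : MultilinearMap ℝ (fun _ : Fin r => CotSpace n x) ℂ)
    (α : CotSpace n x) :
    contract x φ (fun v => ∏ i, ((α (v i) : ℝ) : ℂ)) = φ fun _ => α := by
  have h1 := (sum_smul_of_dual (coordCovec_coordVec (n := n) x)).2 α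
  have h2 : (fun _ : Fin r => α) = fun _ => ∑ j, α (coordVec x j) • coordCovec x j :=
    funext fun _ => h1
  rw [h2, φ.map_sum, contract]
  refine Finset.sum_congr rfl fun J _ => ?_
  rw [φ.map_smul_univ, Complex.real_smul, mul_comm]
  push_cast
  rfl

/-! ### Quantization: leading terms, injectivity, surjectivity -/

section Quantization

variable {n : ℕ} {M : Type*} [TopologicalSpace M] [ChartedSpace (RSpace n) M]
  [IsManifold (𝓡 n) ∞ M]

open Classical in
theorem quantize_eq_sum
    (nabla : CovariantDerivative (𝓡 n) (RSpace n) (TangentSpace (𝓡 n) : M → Type _))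
    (hbar : ℝ) (Φ : SymTensorField n M) {S : Finset ℕ} (hS : Φ.support ⊆ S) (f : M → ℂ) (x : M) :
    quantize nabla hbar Φ f x = ∑ r ∈ S, (-Complex.I * hbar) ^ r *
      contract x ((Φ r).1 x) (symCovDiff nabla f r x) := by
  refine Finset.sum_subset hS fun r _ hr => ?_
  have : Φ r = 0 := by simpa using hr
  simp [this, contract]

theorem quantize_add
    (nabla : CovariantDerivative (𝓡 n) (RSpace n) (TangentSpace (𝓡 n) : M → Type _))
    (hbar : ℝ) (Φ Ψ : SymTensorField n M) (f : M → ℂ) (x : M) :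
    quantize nabla hbar (Φ + Ψ) f x = quantize nabla hbar Φ f x + quantize nabla hbar Ψ f x := by
  classical
  have h1 := Finset.subset_union_left (s₁ := Φ.support) (s₂ := Ψ.support)
  have h2 := Finset.subset_union_right (s₁ := Φ.support) (s₂ := Ψ.support)
  rw [quantize_eq_sum nabla hbar Φ (S := Φ.support ∪ Ψ.support) (by convert h1),
    quantize_eq_sum nabla hbar Ψ (S := Φ.support ∪ Ψ.support) (by convert h2),
    quantize_eq_sum nabla hbar (Φ + Ψ) (S := Φ.support ∪ Ψ.support)
      (by convert DFinsupp.support_add), ← Finset.sum_add_distrib]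
  refine Finset.sum_congr rfl fun r _ => ?_
  simp [contract, add_mul, Finset.sum_add_distrib, mul_add]

theorem quantize_neg
    (nabla : CovariantDerivative (𝓡 n) (RSpace n) (TangentSpace (𝓡 n) : M → Type _))
    (hbar : ℝ) (Φ : SymTensorField n M) (f : M → ℂ) (x : M) :
    quantize nabla hbar (-Φ) f x = -quantize nabla hbar Φ f x := by
  have h0 : quantize nabla hbar 0 f x = 0 := by simp [quantize]
  have := quantize_add nabla hbar (-Φ) Φ f x
  rw [show -Φ + Φ = (0 : SymTensorField n M) from neg_add_cancel Φ, h0] at this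
  exact eq_neg_of_add_eq_zero_left this.symm

theorem quantize_single
    (nabla : CovariantDerivative (𝓡 n) (RSpace n) (TangentSpace (𝓡 n) : M → Type _))
    (hbar : ℝ) {r : ℕ} (φ : symTensors n M r) (f : M → ℂ) (x : M) :
    quantize nabla hbar (DFinsupp.single r φ) f x = (-Complex.I * hbar) ^ r *
      contract x (φ.1 x) (symCovDiff nabla f r x) := by
  classical
  rw [quantize_eq_sum nabla hbar _ (S := {r}) (by convert DFinsupp.support_single_subset)]
  simp

variable [T2Space M]
  {nabla : CovariantDerivative (𝓡 n) (RSpace n) (TangentSpace (𝓡 n) : M → Type _)}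

/-- The quantized operator of a tensor field. -/
def quantizeOp (hsmooth : CovariantDerivative.ContMDiffCovariantDerivative nabla ∞) (hbar : ℝ)
    (Φ : SymTensorField n M) : Module.End ℂ (SmoothFun n M) where
  toFun f := ⟨quantize nabla hbar Φ f.1, by
    classical
    refine contMDiff_finsetSum fun r _ => ?_
    exact (contDiff_const_smul (𝕜 := ℝ) ((-Complex.I * hbar) ^ r)).contMDiff.comp
      (contMDiff_contract (Φ r) (isSmoothTensor_symCovDiff hsmooth f r))⟩
  map_add' f g := SmoothFun.ext fun x => by
    change quantize nabla hbar Φ (f + g).1 x = quantize nabla hbar Φ f.1 x +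
      quantize nabla hbar Φ g.1 x
    simp only [quantize, ← Finset.sum_add_distrib]
    refine Finset.sum_congr rfl fun r _ => ?_
    simp only [contract, symCovDiff, iterCovDiff_add hsmooth, Finset.sum_add_distrib, mul_add]
  map_smul' c f := SmoothFun.ext fun x => by
    change quantize nabla hbar Φ (c • f).1 x = c * quantize nabla hbar Φ f.1 x
    simp only [quantize, Finset.mul_sum]
    refine Finset.sum_congr rfl fun r _ => ?_
    simp only [contract, symCovDiff, iterCovDiff_smul hsmooth, Finset.mul_sum]
    refine Finset.sum_congr rfl fun J _ => Finset.sum_congr rfl fun σ _ => ?_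
    ring

theorem quantize_eq_zero (hsmooth : CovariantDerivative.ContMDiffCovariantDerivative nabla ∞)
    (hbar : ℝ) {Φ : SymTensorField n M} {s : ℕ} (hs : ∀ r, s < r → Φ r = 0) {x : M}
    {f : SmoothFun n M} (hf : f ∈ (vanishingIdeal x : Ideal (SmoothFun n M)) ^ (s + 1)) :
    quantize nabla hbar Φ f x = 0 := by
  classical
  refine Finset.sum_eq_zero fun r hr => ?_
  have hrs : r ≤ s := by
    by_contra h
    exact (DFinsupp.mem_support_iff.1 hr) (hs r (not_le.1 h))
  simp [contract, symCovDiff_eq_zero hsmooth hf hrs]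

/-- Components of order above `s` are zero, and those below `s` vanish because `f ^ s` lies in `𝔪_x
^ (r + 1)` for `r < s`. This is the principal symbol of the quantized operator. -/
theorem quantize_pow (hsmooth : CovariantDerivative.ContMDiffCovariantDerivative nabla ∞)
    (hbar : ℝ) {Φ : SymTensorField n M} {s : ℕ} (hs : ∀ r, s < r → Φ r = 0) {x : M}
    {f : SmoothFun n M} (hf : f ∈ vanishingIdeal x) :
    quantize nabla hbar Φ (f ^ s).1 x = (-Complex.I * hbar) ^ s * s.factorial *
      contract x ((Φ s).1 x) fun v => ∏ i, mvfderiv (𝓡 n) f.1 x (v i) := by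
  classical
  rw [quantize_eq_sum nabla hbar Φ (S := insert s Φ.support) (by
    convert Finset.subset_insert s Φ.support), Finset.sum_eq_single_of_mem s (by simp)]
  · simp only [contract, symCovDiff_pow hsmooth hf, Finset.mul_sum]
    exact Finset.sum_congr rfl fun J _ => by ring
  · intro r _ hrs
    rcases lt_or_gt_of_ne hrs with h | h
    · have h1 : f ^ s ∈ (vanishingIdeal x : Ideal (SmoothFun n M)) ^ (r + 1) :=
        Ideal.pow_le_pow_right h (Ideal.pow_mem_pow hf s)
      simp [contract, symCovDiff_eq_zero hsmooth h1 le_rfl]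
    · simp [hs r h, contract]

theorem exists_isDiffOpOfOrder_quantizeOp
    (hsmooth : CovariantDerivative.ContMDiffCovariantDerivative nabla ∞) (hbar : ℝ)
    (Φ : SymTensorField n M) : ∃ r, IsDiffOpOfOrder r (quantizeOp hsmooth hbar Φ) := by
  classical
  refine ⟨Φ.support.sup id, fun x f hf => ?_⟩
  refine quantize_eq_zero hsmooth hbar (fun r hr => ?_) hf
  by_contra h
  exact absurd (Finset.le_sup (f := id) (DFinsupp.mem_support_iff.2 h)) (not_le.2 hr)

/-- Testing on `s`-th powers of functions with prescribed real differential shows that the component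
of highest order `s` vanishes on the diagonal, against the choice of `s`. -/
theorem eq_zero_of_quantize_eq_zero
    (hsmooth : CovariantDerivative.ContMDiffCovariantDerivative nabla ∞) {hbar : ℝ}
    (hhbar : hbar ≠ 0) {Φ : SymTensorField n M}
    (h : ∀ (f : SmoothFun n M) (x : M), quantize nabla hbar Φ f x = 0) : Φ = 0 := by
  classical
  by_contra hΦ
  have hne : Φ.support.Nonempty := by
    rwa [Finset.nonempty_iff_ne_empty, Ne, DFinsupp.support_eq_empty]
  let s := Φ.support.max' hne
  have hs : ∀ r, s < r → Φ r = 0 := fun r hr => by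
    by_contra h0
    exact absurd (Finset.le_max' _ _ (DFinsupp.mem_support_iff.2 h0)) (not_le.2 hr)
  refine DFinsupp.mem_support_iff.1 (Finset.max'_mem Φ.support hne) ?_
  refine Subtype.ext (funext fun x => ?_)
  refine eq_zero_of_diagonal_eq_zero _ ((Φ s).2.1 x) fun α => ?_
  have h1 := quantize_pow hsmooth hbar hs (primitiveAt_mem x α)
  rw [h] at h1
  have h2 : (fun v : Fin s → TangentSpace (𝓡 n) x =>
      ∏ i, mvfderiv (𝓡 n) (primitiveAt x α).1 x (v i)) =
      fun v => ∏ i, ((α (v i) : ℝ) : ℂ) :=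
    funext fun v => Finset.prod_congr rfl fun i _ => diffAt_primitiveAt x α (v i)
  rw [h2, contract_prod_ofReal] at h1
  have h3 : (-Complex.I * hbar) ^ s * (s.factorial : ℂ) ≠ 0 :=
    mul_ne_zero (pow_ne_zero _ (mul_ne_zero (neg_ne_zero.2 Complex.I_ne_zero)
      (by exact_mod_cast hhbar))) (by exact_mod_cast s.factorial_ne_zero)
  exact (mul_eq_zero.1 h1.symm).resolve_left h3

/-- Induction on the order, shifted by one: the hypothesis for `s + 1` is order at most `s`, and for
`s = 0` it says `P = 0`, since `𝔪_x ^ 0` is the whole ring. -/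
theorem exists_isQuantized (hsmooth : CovariantDerivative.ContMDiffCovariantDerivative nabla ∞)
    {hbar : ℝ} (hhbar : hbar ≠ 0) (s : ℕ) : ∀ P : Module.End ℂ (SmoothFun n M),
      (∀ x : M, ∀ f ∈ (vanishingIdeal x : Ideal (SmoothFun n M)) ^ s, P f ∈ vanishingIdeal x) →
      ∃ Φ : SymTensorField n M, IsQuantized nabla hbar Φ P := by
  induction s with
  | zero =>
    intro P hP
    refine ⟨0, fun f x => ?_⟩
    have h1 : quantize nabla hbar (0 : SymTensorField n M) f.1 x = 0 := by simp [quantize]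
    rw [h1]
    exact hP x f (by simp)
  | succ s ih =>
    intro P hP
    -- The factor from `quantize_pow`; dividing the symbol by it makes the leading terms of `P` and
    -- of the quantization of `Ψ` agree.
    let c : ℂ := (-Complex.I * hbar) ^ s * s.factorial
    have hc : c ≠ 0 :=
      mul_ne_zero (pow_ne_zero _ (mul_ne_zero (neg_ne_zero.2 Complex.I_ne_zero)
        (by exact_mod_cast hhbar))) (by exact_mod_cast s.factorial_ne_zero)
    let φ : symTensors n M s := c⁻¹ • symbol (s := s) hP
    let Ψ : SymTensorField n M := DFinsupp.single s φ
    have hΨ : ∀ r, s < r → Ψ r = 0 := fun r hr => DFinsupp.single_eq_of_ne (ne_of_gt hr)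
    obtain ⟨Φ, hΦ⟩ := ih (P - quantizeOp hsmooth hbar Ψ) fun x => by
      refine eq_zero_of_pow_eq_zero ((evalHom x).toLinearMap ∘ₗ (P - quantizeOp hsmooth hbar Ψ))
        (fun f hf => ?_) (fun f hf => ?_)
      · have h1 : P f x = 0 := hP x f hf
        have h2 := quantize_eq_zero hsmooth hbar hΨ hf
        change P f x - quantize nabla hbar Ψ f x = 0
        rw [h1, h2, sub_zero]
      · change P (f ^ s) x - quantize nabla hbar Ψ (f ^ s).1 x = 0
        rw [quantize_pow hsmooth hbar hΨ hf, apply_pow_eq_symbol hP hf, sub_eq_zero]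
        have h3 : (Ψ s).1 x = c⁻¹ • (symbol (s := s) hP).1 x := by simp [Ψ, φ]
        simp only [h3, contract, Finset.mul_sum]
        refine Finset.sum_congr rfl fun J _ => ?_
        change _ = c * _
        rw [smul_apply, smul_eq_mul]
        field_simp
    refine ⟨Φ + Ψ, fun f x => ?_⟩
    rw [quantize_add, ← hΦ f x]
    change P f x = (P f x - quantize nabla hbar Ψ f x) + _
    ring

end Quantization

/-- The coefficients of a polynomial of degree at most `N` are linear combinations of its values
at `0, …, N`. -/
theorem exists_coefficient_extraction (N : ℕ) : ∃ c : ℕ → ℕ → ℝ, ∀ k, ∀ j ∈ Finset.range (N + 1),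
    ∑ m ∈ Finset.range (N + 1), c k m * (m : ℝ) ^ j = if j = k then 1 else 0 := by
  -- Lagrange interpolation at the nodes `0, …, N` reproduces `X ^ j` for `j ≤ N`; the identity
  -- compares its `k`-th coefficients.
  refine ⟨fun k m => (Lagrange.basis (Finset.range (N + 1)) (fun i : ℕ => (i : ℝ)) m).coeff k,
    fun k j hj => ?_⟩
  have hinj : Set.InjOn (fun i : ℕ => (i : ℝ)) (Finset.range (N + 1)) :=
    Nat.cast_injective.injOn
  have h := Lagrange.eq_interpolate_of_eval_eq (s := Finset.range (N + 1))
    (v := fun i : ℕ => (i : ℝ)) (f := (Polynomial.X : Polynomial ℝ) ^ j)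
    (fun m : ℕ => (m : ℝ) ^ j) hinj
    (by rw [Polynomial.degree_X_pow, Finset.card_range]
        exact_mod_cast Finset.mem_range.1 hj) (fun i _ => by simp)
  have h1 := congrArg (fun p : Polynomial ℝ => p.coeff k) h
  simp only [Lagrange.interpolate_apply, Polynomial.finsetSum_coeff, Polynomial.coeff_C_mul,
    Polynomial.coeff_X_pow] at h1
  rw [← (show (if k = j then (1 : ℝ) else 0) = if j = k then 1 else 0 by simp [eq_comm]), h1]
  exact Finset.sum_congr rfl fun m _ => mul_comm _ _

/-- The homogeneous parts of a polynomial function are combinations of its dilations. -/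
theorem sum_smul_dilation {V : Type*} [AddCommGroup V] [Module ℝ V] {N : ℕ} {c : ℕ → ℕ → ℝ}
    (hc : ∀ k, ∀ j ∈ Finset.range (N + 1),
      ∑ m ∈ Finset.range (N + 1), c k m * (m : ℝ) ^ j = if j = k then 1 else 0)
    (Q : Π k : ℕ, MultilinearMap ℝ (fun _ : Fin k => V) ℂ) {k : ℕ}
    (hk : k ∈ Finset.range (N + 1)) (a : V) :
    ∑ m ∈ Finset.range (N + 1), c k m •
      ∑ j ∈ Finset.range (N + 1), Q j (fun _ => (m : ℝ) • a) = Q k (fun _ => a) := by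
  simp only [Finset.smul_sum]
  rw [Finset.sum_comm]
  have (j : ℕ) (hj : j ∈ Finset.range (N + 1)) :
      ∑ m ∈ Finset.range (N + 1), c k m • Q j (fun _ => (m : ℝ) • a) =
        (if j = k then (1 : ℝ) else 0) • Q j (fun _ => a) := by
    rw [← hc k j hj, Finset.sum_smul]
    refine Finset.sum_congr rfl fun m _ => ?_
    rw [(Q j).map_smul_univ (fun _ => (m : ℝ)) (fun _ => a)]
    simp [mul_smul]
  rw [Finset.sum_congr rfl this]
  simp [hk]

/-! ### Symmetric tensor fields and fibrewise polynomial functions -/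

section Hamiltonian

variable {n : ℕ} {M : Type*} [TopologicalSpace M] [ChartedSpace (RSpace n) M]
  [IsManifold (𝓡 n) ∞ M]

open Classical in
theorem hamiltonianOf_eq_sum (Φ : SymTensorField n M) {S : Finset ℕ} (hS : Φ.support ⊆ S)
    (z : CotBundle n M) :
    hamiltonianOf Φ z = ∑ r ∈ S, (Φ r).1 z.1 (fun _ => z.2) := by
  refine Finset.sum_subset hS fun r _ hr => ?_
  have : Φ r = 0 := by simpa using hr
  simp [this]

theorem hamiltonianOf_add (Φ Ψ : SymTensorField n M) (z : CotBundle n M) :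
    hamiltonianOf (Φ + Ψ) z = hamiltonianOf Φ z + hamiltonianOf Ψ z := by
  classical
  have h1 := Finset.subset_union_left (s₁ := Φ.support) (s₂ := Ψ.support)
  have h2 := Finset.subset_union_right (s₁ := Φ.support) (s₂ := Ψ.support)
  rw [hamiltonianOf_eq_sum Φ (S := Φ.support ∪ Ψ.support) (by convert h1),
    hamiltonianOf_eq_sum Ψ (S := Φ.support ∪ Ψ.support) (by convert h2),
    hamiltonianOf_eq_sum (Φ + Ψ) (S := Φ.support ∪ Ψ.support)
      (by convert DFinsupp.support_add), ← Finset.sum_add_distrib]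
  exact Finset.sum_congr rfl fun r _ => by simp

theorem hamiltonianOf_neg (Φ : SymTensorField n M) (z : CotBundle n M) :
    hamiltonianOf (-Φ) z = -hamiltonianOf Φ z := by
  have h0 : hamiltonianOf (0 : SymTensorField n M) z = 0 := by simp [hamiltonianOf]
  have := hamiltonianOf_add (-Φ) Φ z
  rw [show -Φ + Φ = (0 : SymTensorField n M) from neg_add_cancel Φ, h0] at this
  exact eq_neg_of_add_eq_zero_left this.symm

theorem hamiltonianOf_single {r : ℕ} (φ : symTensors n M r) (z : CotBundle n M) :
    hamiltonianOf (DFinsupp.single r φ) z = φ.1 z.1 (fun _ => z.2) := by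
  classical
  rw [hamiltonianOf_eq_sum _ (S := {r}) (by convert DFinsupp.support_single_subset)]
  simp

theorem exists_range_support (Φ : SymTensorField n M) : ∃ N : ℕ, ∀ z : CotBundle n M,
    hamiltonianOf Φ z = ∑ r ∈ Finset.range (N + 1), (Φ r).1 z.1 (fun _ => z.2) := by
  classical
  refine ⟨Φ.support.sup id, fun z => hamiltonianOf_eq_sum Φ (fun r hr => ?_) z⟩
  have hr' : r ∈ Φ.support := by convert hr
  exact Finset.mem_range_succ_iff.2 (Finset.le_sup (f := id) hr')

/-- Dilations separate the homogeneous components on the diagonal, and a symmetric form is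
determined there. -/
theorem eq_zero_of_hamiltonianOf_eq_zero {Φ : SymTensorField n M}
    (h : ∀ z : CotBundle n M, hamiltonianOf Φ z = 0) : Φ = 0 := by
  classical
  let N := Φ.support.sup id
  obtain ⟨c, hc⟩ := exists_coefficient_extraction N
  ext1 k
  by_cases hk : k ∈ Φ.support
  · have hsub : Φ.support ⊆ Finset.range (N + 1) := fun r hr =>
      Finset.mem_range_succ_iff.2 (Finset.le_sup (f := id) hr)
    refine Subtype.ext (funext fun x => ?_)
    refine eq_zero_of_diagonal_eq_zero _ ((Φ k).2.1 x) fun α => ?_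
    rw [← sum_smul_dilation hc (fun j => (Φ j).1 x) (hsub hk) α]
    refine Finset.sum_eq_zero fun m _ => ?_
    have := h ⟨x, (m : ℝ) • α⟩
    rw [hamiltonianOf_eq_sum Φ (S := Finset.range (N + 1)) (by convert hsub)] at this
    exact (congrArg (c k m • ·) this).trans (smul_zero _)
  · simpa using hk

theorem hamiltonianOf_injective : Function.Injective (hamiltonianOf (n := n) (M := M)) := by
  intro Φ Ψ h
  have : Φ + -Ψ = 0 := eq_zero_of_hamiltonianOf_eq_zero fun z => by
    rw [hamiltonianOf_add, hamiltonianOf_neg, h, add_neg_cancel]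
  exact add_neg_eq_zero.1 this

theorem isSmoothForm_smul_sum {ι : Type*} (s : Finset ι) {a : ι → Π x : M, CotSpace n x}
    (ha : ∀ i, IsSmoothForm (a i)) (c : ℝ) : IsSmoothForm (fun x => c • ∑ i ∈ s, a i x) :=
  ContMDiff.const_smul_section (ContMDiff.sum_section fun i _ => ha i)

/-- The fibrewise forms `Q` are chosen with no regularity in `x` and no symmetry. Symmetrizing them
gives forms expressible through `F` alone, and smoothness follows from that of `F`. -/
theorem exists_hamiltonianOf_eq {F : CotBundle n M → ℂ} (hF : IsPolyHamiltonian F) :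
    ∃ Φ : SymTensorField n M, hamiltonianOf Φ = F := by
  classical
  obtain ⟨hs, N, hN⟩ := hF
  choose Q hQ using hN
  obtain ⟨c, hc⟩ := exists_coefficient_extraction N
  have hdil {k : ℕ} (hk : k ∈ Finset.range (N + 1)) (x : M) (a : CotSpace n x) :
      Q x k (fun _ => a) = ∑ m ∈ Finset.range (N + 1), c k m • F ⟨x, (m : ℝ) • a⟩ := by
    rw [← sum_smul_dilation hc (Q x) hk a]
    exact Finset.sum_congr rfl fun m _ => by rw [hQ]
  let q (k : ℕ) (x : M) : MultilinearMap ℝ (fun _ : Fin k => CotSpace n x) ℂ :=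
    (k.factorial : ℝ)⁻¹ • ∑ σ : Equiv.Perm (Fin k), (Q x k).domDomCongr σ
  have hq (k : ℕ) (x : M) (a : Fin k → CotSpace n x) : q k x a =
      (k.factorial : ℝ)⁻¹ • ∑ σ : Equiv.Perm (Fin k), Q x k (fun i => a (σ i)) := by
    simp [q]
  have hsmooth {k : ℕ} (hk : k ∈ Finset.range (N + 1)) : q k ∈ symTensors n M k := by
    refine ⟨fun x σ a => ?_, fun a ha => ?_⟩
    · rw [hq, hq]
      congr 1
      exact Fintype.sum_equiv (Equiv.mulLeft σ) _ _ fun τ => rfl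
    -- Polarization followed by dilation writes the form as a finite combination of `F` along smooth
    -- 1-forms.
    · have h1 : (fun x => q k x fun i => a i x) = fun x => (k.factorial : ℝ)⁻¹ •
          ∑ S : Finset (Fin k), ((-1 : ℤ) ^ (Sᶜ).card : ℝ) • ∑ m ∈ Finset.range (N + 1),
            c k m • F ⟨x, (m : ℝ) • ∑ i ∈ S, a i x⟩ := by
        funext x
        rw [hq, ← sum_powerset_neg_one_pow_smul_diagonal (Q x k) (fun i => a i x)]
        congr 1
        refine Finset.sum_congr rfl fun S _ => ?_
        rw [← hdil hk]
        simp
      rw [h1]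
      have hsmul (r : ℝ) {g : M → ℂ} (hg : ContMDiff (𝓡 n) 𝓘(ℝ, ℂ) ∞ g) :
          ContMDiff (𝓡 n) 𝓘(ℝ, ℂ) ∞ (fun x => r • g x) :=
        (contDiff_const_smul (𝕜 := ℝ) r).contMDiff.comp hg
      refine hsmul _ (contMDiff_finsetSum fun S _ => hsmul _
        (contMDiff_finsetSum fun m _ => hsmul _ ?_))
      exact hs.comp (isSmoothForm_smul_sum S ha m)
  let φ (k : ℕ) : symTensors n M k := if hk : k ∈ Finset.range (N + 1) then ⟨q k, hsmooth hk⟩ else 0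
  let Φ : SymTensorField n M := DFinsupp.mk (Finset.range (N + 1)) fun k => φ k
  refine ⟨Φ, funext fun z => ?_⟩
  rw [hamiltonianOf_eq_sum Φ (S := Finset.range (N + 1)) (by convert DFinsupp.support_mk_subset)]
  refine Eq.trans (Finset.sum_congr rfl fun k hk => ?_) (hQ z.1 z.2).symm
  have h1 : (Φ k).1 = q k := by
    have : Φ k = φ k := by simp only [Φ, DFinsupp.mk_apply, hk, dite_true]
    rw [this]
    simp only [φ, hk, dite_true]
  rw [h1, hq]
  simp only [Finset.sum_const, Finset.card_univ, Fintype.card_perm, Fintype.card_fin]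
  rw [← Nat.cast_smul_eq_nsmul ℝ, smul_smul, inv_mul_cancel₀ (by exact_mod_cast k.factorial_ne_zero),
    one_smul]

variable [T2Space M]

/-- Smoothness of `Φ` is known only on 1-forms of `M`, so the covector variable is expanded in a
coframe pulled back from the base. -/
theorem contMDiff_symTensor_diagonal {r : ℕ} (Φ : symTensors n M r) :
    ContMDiff (cotModel n) 𝓘(ℝ, ℂ) ∞ (fun z : CotBundle n M => Φ.1 z.1 (fun _ => z.2)) := by
  intro z₀
  obtain ⟨ξ, E, hξ, h⟩ := exists_coord_frame (n := n) z₀.1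
  have hproj := contMDiff_proj (n := ∞) (IB := 𝓡 n) (F := RSpace n →L[ℝ] ℝ)
    (fun x : M => CotSpace n x)
  have h1 : ContMDiffAt (cotModel n) 𝓘(ℝ, ℂ) ∞ (fun z : CotBundle n M =>
      ∑ J : Fin r → Fin n, (∏ i, z.2 (E (J i) z.1)) •
        Φ.1 z.1 (fun i => mvfderiv (𝓡 n) (ξ (J i)) z.1)) z₀ := by
    refine contMDiffAt_finsetSum fun J _ =>
      (contDiff_smul (𝕜 := ℝ) (F := ℂ)).contMDiff.contMDiffAt.comp z₀
        (ContMDiffAt.prodMk_space ?_ ?_)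
    · exact contMDiffAt_finsetProd (t := Finset.univ)
        (f := fun i (z : CotBundle n M) => z.2 (E (J i) z.1))
        fun i _ => contMDiffAt_cot_apply contMDiffAt_id (E (J i))
    · exact (Φ.2.2 (fun i y => mvfderiv (𝓡 n) (ξ (J i)) y)
        fun i => isSmoothForm_mvfderiv (hξ _)).contMDiffAt.comp z₀ hproj.contMDiffAt
  refine h1.congr_of_eventuallyEq ?_
  filter_upwards [hproj.continuous.continuousAt.eventually h] with z hz
  have h2 := (sum_smul_of_dual hz).2 z.2
  have h3 : (fun _ : Fin r => z.2) =
      fun _ => ∑ j, z.2 (E j z.1) • (mvfderiv (𝓡 n) (ξ j) z.1 : CotSpace n z.1) :=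
    funext fun _ => h2
  rw [h3, (Φ.1 z.1).map_sum]
  exact Finset.sum_congr rfl fun J _ => (Φ.1 z.1).map_smul_univ _ _

theorem isPolyHamiltonian_hamiltonianOf (Φ : SymTensorField n M) :
    IsPolyHamiltonian (hamiltonianOf Φ) := by
  obtain ⟨N, hN⟩ := exists_range_support Φ
  refine ⟨?_, N, fun x => ⟨fun k => (Φ k).1 x, fun α => hN ⟨x, α⟩⟩⟩
  rw [show hamiltonianOf Φ = _ from funext hN]
  exact contMDiff_finsetSum fun r _ => contMDiff_symTensor_diagonal (Φ r)

end Hamiltonian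

/-- A map that preserves a linear 1-form preserves its exterior derivative. -/
theorem alternation_fderiv {E : Type*} [NormedAddCommGroup E] [NormedSpace ℝ E]
    (lam : E →L[ℝ] E →L[ℝ] ℝ) {τ : E → E} {y : E} (hτ : ContDiffAt ℝ 2 τ y)
    (h : ∀ᶠ x in nhds y, ∀ w, lam x w = lam (τ x) (fderiv ℝ τ x w)) (u v : E) :
    lam u v - lam v u =
      lam (fderiv ℝ τ y u) (fderiv ℝ τ y v) - lam (fderiv ℝ τ y v) (fderiv ℝ τ y u) := by
  have h1 : HasFDerivAt τ (fderiv ℝ τ y) y :=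
    (hτ.differentiableAt (by norm_num)).hasFDerivAt
  have h2 : HasFDerivAt (fderiv ℝ τ) (fderiv ℝ (fderiv ℝ τ) y) y :=
    ((hτ.fderiv_right (m := 1) (by norm_num)).differentiableAt (by norm_num)).hasFDerivAt
  have hsymm : IsSymmSndFDerivAt ℝ τ y := hτ.isSymmSndFDerivAt (by simp)
  -- Differentiate the invariance identity in the direction `u`. The extra term contains the second
  -- derivative of `τ`, which is symmetric and cancels in the alternation.
  have key (u w : E) : lam u w = lam (fderiv ℝ τ y u) (fderiv ℝ τ y w) +
      lam (τ y) (fderiv ℝ (fderiv ℝ τ) y u w) := by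
    have d1 : HasFDerivAt (fun x => lam x w) (lam.flip w) y := (lam.flip w).hasFDerivAt
    have d2 := (lam.hasFDerivAt.comp y h1).clm_apply (h2.clm_apply (hasFDerivAt_const w y))
    have d3 := d2.congr_of_eventuallyEq (h.mono fun x hx => hx w)
    have := congrArg (fun A : E →L[ℝ] ℝ => A u) (d1.unique d3)
    simpa [add_comm] using this
  have e1 := key u v
  have e2 := key v u
  rw [hsymm.eq v u] at e2
  linarith

/-! ### The standard symplectic vector space -/

section Linear

variable {n : ℕ}

variable (n) in
/-- The model vector space of the cotangent bundle. -/
abbrev PhaseSpace : Type := RSpace n × (RSpace n →L[ℝ] ℝ)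

variable (n) in
/-- The Liouville form of the model space: `λ_(q, p)(a, b) = p(a)`. -/
def linearLiouville : PhaseSpace n →L[ℝ] PhaseSpace n →L[ℝ] ℝ :=
  ((ContinuousLinearMap.compL ℝ (PhaseSpace n) (RSpace n) ℝ).flip
    (ContinuousLinearMap.fst ℝ (RSpace n) (RSpace n →L[ℝ] ℝ))).comp
      (ContinuousLinearMap.snd ℝ (RSpace n) (RSpace n →L[ℝ] ℝ))

@[simp]
theorem linearLiouville_apply (u v : PhaseSpace n) : linearLiouville n u v = u.2 v.1 := rfl

/-- The standard symplectic form. -/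
def linearSymplectic (u v : PhaseSpace n) : ℝ := u.2 v.1 - v.2 u.1

theorem clm_eq_sum_proj (β : RSpace n →L[ℝ] ℝ) :
    β = ∑ j, β (EuclideanSpace.single j (1 : ℝ)) •
      (EuclideanSpace.proj j : RSpace n →L[ℝ] ℝ) := by
  refine (sum_smul_of_dual (M := RSpace n) (x := 0)
    (α := fun j => (EuclideanSpace.proj j : RSpace n →L[ℝ] ℝ))
    (e := fun j => EuclideanSpace.single j (1 : ℝ)) fun i j => ?_).2 β
  exact (coordCovec_coordVec (M := RSpace n) 0 i j)

/-- The vector that represents a linear form with respect to the standard symplectic form. -/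
def linearSharp (L : PhaseSpace n →L[ℝ] ℝ) : PhaseSpace n :=
  (-∑ j, L (0, EuclideanSpace.proj j) • EuclideanSpace.single j (1 : ℝ),
    L.comp (ContinuousLinearMap.inl ℝ (RSpace n) (RSpace n →L[ℝ] ℝ)))

theorem linearSymplectic_linearSharp (L : PhaseSpace n →L[ℝ] ℝ) (v : PhaseSpace n) :
    linearSymplectic (linearSharp L) v = L v := by
  have h1 : L v = L (v.1, 0) + L (0, v.2) := by rw [← map_add]; simp
  have h2 : L (0, v.2) = ∑ j, v.2 (EuclideanSpace.single j (1 : ℝ)) *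
      L (0, EuclideanSpace.proj j) := by
    have h3 : L (0, v.2) = (L.comp (ContinuousLinearMap.inr ℝ (RSpace n) (RSpace n →L[ℝ] ℝ)))
      v.2 := rfl
    rw [h3]
    conv_lhs => rw [clm_eq_sum_proj v.2]
    rw [map_sum]
    exact Finset.sum_congr rfl fun j _ => map_smul _ _ _
  rw [h1, h2]
  simp only [linearSymplectic, linearSharp, map_neg, map_sum, map_smul, smul_eq_mul, sub_neg_eq_add]
  congr 1
  exact Finset.sum_congr rfl fun j _ => mul_comm _ _

/-- Nondegeneracy: coordinate covectors detect the position component, and vectors `(a, 0)` the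
momentum component. -/
theorem eq_of_linearSymplectic_eq {u v : PhaseSpace n}
    (h : ∀ w, linearSymplectic u w = linearSymplectic v w) : u = v := by
  refine Prod.ext ?_ ?_
  · ext j
    have := h (0, EuclideanSpace.proj j)
    simpa [linearSymplectic] using this
  · ext a
    have := h (a, 0)
    simpa [linearSymplectic] using this

theorem contDiff_linearSharp : ContDiff ℝ ∞ (linearSharp (n := n)) := by
  unfold linearSharp
  fun_prop

theorem linearSymplectic_fderiv {τ : PhaseSpace n → PhaseSpace n} {y : PhaseSpace n}
    (hτ : ContDiffAt ℝ 2 τ y)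
    (h : ∀ᶠ x in nhds y, ∀ w, linearLiouville n x w = linearLiouville n (τ x) (fderiv ℝ τ x w))
    (u v : PhaseSpace n) :
    linearSymplectic u v = linearSymplectic (fderiv ℝ τ y u) (fderiv ℝ τ y v) :=
  alternation_fderiv (linearLiouville n) hτ h u v

end Linear

/-! ### The symplectic form in charts of the cotangent bundle -/

section Charts

variable {n : ℕ} {M : Type*} [TopologicalSpace M] [ChartedSpace (RSpace n) M]
  [IsManifold (𝓡 n) ∞ M]

theorem extChartAt_cot_apply (z ζ : CotBundle n M) :
    extChartAt (cotModel n) z ζ = (extChartAt (𝓡 n) z.1 ζ.1,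
      ζ.2.comp ((trivializationAt (RSpace n) (TangentSpace (𝓡 n) : M → Type _) z.1).symmL ℝ
        ζ.1)) := by
  rw [FiberBundle.extChartAt]
  have h := cot_trivializationAt_apply z.1 ζ
  change ((extChartAt (𝓡 n) z.1) (trivializationAt (RSpace n →L[ℝ] ℝ)
    (fun x : M => CotSpace n x) z.1 ζ).1, (trivializationAt (RSpace n →L[ℝ] ℝ)
    (fun x : M => CotSpace n x) z.1 ζ).2) = _
  rw [h]

theorem mem_extChartAt_cot_source_iff {z ζ : CotBundle n M} :
    ζ ∈ (extChartAt (cotModel n) z).source ↔ ζ.1 ∈ (chartAt (RSpace n) z.1).source := by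
  rw [FiberBundle.extChartAt]
  simp only [mfld_simps]
  refine ⟨fun h => h.1.1, fun h => ⟨⟨h, trivial⟩, ?_⟩⟩
  have := congrArg Prod.fst (cot_trivializationAt_apply z.1 ζ)
  exact this ▸ h

theorem proj_extChartAt_cot_symm {z : CotBundle n M} {y : PhaseSpace n}
    (hy : y ∈ (extChartAt (cotModel n) z).target) :
    ((extChartAt (cotModel n) z).symm y).1 = (extChartAt (𝓡 n) z.1).symm y.1 := by
  have h1 := (extChartAt (cotModel n) z).map_target hy
  have h2 := (extChartAt (cotModel n) z).right_inv hy
  rw [extChartAt_cot_apply] at h2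
  rw [← congrArg Prod.fst h2]
  refine ((extChartAt (𝓡 n) z.1).left_inv ?_).symm
  rw [extChartAt_source]
  exact mem_extChartAt_cot_source_iff.1 h1

theorem mdifferentiableAt_extChartAt_cot_symm {z : CotBundle n M} {y : PhaseSpace n}
    (hy : y ∈ (extChartAt (cotModel n) z).target) :
    MDifferentiableAt 𝓘(ℝ, PhaseSpace n) (cotModel n) (extChartAt (cotModel n) z).symm y := by
  have := mdifferentiableWithinAt_extChartAt_symm (I := cotModel n) hy
  rwa [ModelWithCorners.range_eq_univ, mdifferentiableWithinAt_univ] at this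

/-- The reason for `θ = p dx`: the fibre coordinate of a covector is its composite with the inverse
tangent trivialization, and that inverse is the derivative of the inverse chart of `M`. -/
theorem liouvilleInChart_apply (z : CotBundle n M) {y : PhaseSpace n}
    (hy : y ∈ (extChartAt (cotModel n) z).target) (w : PhaseSpace n) :
    liouvilleInChart z y w = linearLiouville n y w := by
  let ζ := (extChartAt (cotModel n) z).symm y
  have h1 := mem_extChartAt_cot_source_iff.1 ((extChartAt (cotModel n) z).map_target hy)
  have h2 : extChartAt (cotModel n) z ζ = y := (extChartAt (cotModel n) z).right_inv hy
  rw [extChartAt_cot_apply] at h2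
  have hproj : MDifferentiableAt (cotModel n) (𝓡 n) (TotalSpace.proj : CotBundle n M → M) ζ :=
    (contMDiff_proj (n := ∞) (IB := 𝓡 n) (F := RSpace n →L[ℝ] ℝ)
      (fun x : M => CotSpace n x)).contMDiffAt.mdifferentiableAt (by simp)
  have h3 := mfderiv_comp y hproj (mdifferentiableAt_extChartAt_cot_symm hy)
  have h4 : (TotalSpace.proj ∘ (extChartAt (cotModel n) z).symm) =ᶠ[nhds y]
      (extChartAt (𝓡 n) z.1).symm ∘ Prod.fst := by
    filter_upwards [(isOpen_extChartAt_target (I := cotModel n) z).mem_nhds hy] with p hp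
    exact proj_extChartAt_cot_symm hp
  have hy1 : y.1 ∈ (extChartAt (𝓡 n) z.1).target := by
    rw [← congrArg Prod.fst h2]
    exact (extChartAt (𝓡 n) z.1).map_source (by rw [extChartAt_source]; exact h1)
  have h5 : MDifferentiableAt 𝓘(ℝ, RSpace n) (𝓡 n) (extChartAt (𝓡 n) z.1).symm y.1 := by
    have := mdifferentiableWithinAt_extChartAt_symm (I := 𝓡 n) hy1
    rwa [ModelWithCorners.range_eq_univ, mdifferentiableWithinAt_univ] at this
  have hfst : MDifferentiableAt 𝓘(ℝ, PhaseSpace n) 𝓘(ℝ, RSpace n)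
      (Prod.fst : PhaseSpace n → RSpace n) y := differentiableAt_fst.mdifferentiableAt
  have h6 := mfderiv_comp y h5 hfst
  have h7 (a : RSpace n) : (trivializationAt (RSpace n) (TangentSpace (𝓡 n) : M → Type _)
      z.1).symmL ℝ ζ.1 a =
      mfderiv 𝓘(ℝ, RSpace n) (𝓡 n) (extChartAt (𝓡 n) z.1).symm y.1 a := by
    have t1 := TangentBundle.symmL_trivializationAt (I := 𝓡 n) h1
    have t2 : mfderivWithin 𝓘(ℝ, RSpace n) (𝓡 n) (extChartAt (𝓡 n) z.1).symm (Set.range (𝓡 n))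
        (extChartAt (𝓡 n) z.1 ζ.1) =
        mfderiv 𝓘(ℝ, RSpace n) (𝓡 n) (extChartAt (𝓡 n) z.1).symm y.1 := by
      rw [ModelWithCorners.range_eq_univ, mfderivWithin_univ, ← congrArg Prod.fst h2]
    exact congrArg (fun L : RSpace n →L[ℝ] RSpace n => L a) (t1.trans t2)
  have h8 : mfderiv 𝓘(ℝ, PhaseSpace n) 𝓘(ℝ, RSpace n) (Prod.fst : PhaseSpace n → RSpace n) y =
      ContinuousLinearMap.fst ℝ (RSpace n) (RSpace n →L[ℝ] ℝ) := by
    rw [mfderiv_eq_fderiv]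
    exact fderiv_fst
  have e1 : liouvilleInChart z y w = ζ.2 (mfderiv 𝓘(ℝ, PhaseSpace n) (𝓡 n)
      (TotalSpace.proj ∘ (extChartAt (cotModel n) z).symm) y w) := by
    rw [h3]
    rfl
  have e2 : mfderiv 𝓘(ℝ, PhaseSpace n) (𝓡 n)
      (TotalSpace.proj ∘ (extChartAt (cotModel n) z).symm) y w =
      (trivializationAt (RSpace n) (TangentSpace (𝓡 n) : M → Type _) z.1).symmL ℝ ζ.1 w.1 := by
    rw [h4.mfderiv_eq, h6, h8]
    exact (h7 w.1).symm
  rw [e1, linearLiouville_apply, ← congrArg Prod.snd h2]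
  exact congrArg ζ.2 e2

theorem mfderiv_extChartAt_cot_self (z : CotBundle n M) :
    mfderiv (cotModel n) 𝓘(ℝ, PhaseSpace n) (extChartAt (cotModel n) z) z =
      ContinuousLinearMap.id ℝ (PhaseSpace n) :=
  mfderiv_extChartAt_self

/-- The derivative at `z` of the preferred chart at `z` is the identity of the model space, so the
standard form appears with no change of basis. This settles algebra at one point; smoothness in `z`
needs a fixed chart. -/
theorem symplecticForm_eq (z : CotBundle n M) (u v : TangentSpace (cotModel n) z) :
    symplecticForm z u v = linearSymplectic (n := n) u v := by
  have h1 : liouvilleInChart z =ᶠ[nhds (extChartAt (cotModel n) z z)] linearLiouville n := by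
    filter_upwards [extChartAt_target_mem_nhds (I := cotModel n) z] with y hy
    exact ContinuousLinearMap.ext fun w => liouvilleInChart_apply z hy w
  simp only [symplecticForm]
  rw [h1.fderiv_eq, ContinuousLinearMap.fderiv, mfderiv_extChartAt_cot_self]
  rfl

/-- The pullback of the covector `θ_p` by a linear map. -/
def liouvilleComp (p : CotBundle n M) (A : PhaseSpace n →L[ℝ] PhaseSpace n) :
    PhaseSpace n →L[ℝ] ℝ :=
  ContinuousLinearMap.comp (M₂ := PhaseSpace n) (liouville p) A

/-- The pullback of the Liouville form by a map from the model space. -/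
def liouvillePullback (g : PhaseSpace n → CotBundle n M) (y : PhaseSpace n) :
    PhaseSpace n →L[ℝ] ℝ :=
  liouvilleComp (g y) (mfderiv 𝓘(ℝ, PhaseSpace n) (cotModel n) g y)

theorem liouvillePullback_congr {g g' : PhaseSpace n → CotBundle n M} {y : PhaseSpace n}
    (h : g =ᶠ[nhds y] g') : liouvillePullback g y = liouvillePullback g' y := by
  have h2 : (mfderiv 𝓘(ℝ, PhaseSpace n) (cotModel n) g y : PhaseSpace n →L[ℝ] PhaseSpace n) =
    mfderiv 𝓘(ℝ, PhaseSpace n) (cotModel n) g' y := h.mfderiv_eq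
  exact congrArg₂ liouvilleComp h.self_of_nhds h2

theorem liouvillePullback_comp {g : PhaseSpace n → CotBundle n M} {τ : PhaseSpace n → PhaseSpace n}
    {y : PhaseSpace n} (hg : MDifferentiableAt 𝓘(ℝ, PhaseSpace n) (cotModel n) g (τ y))
    (hτ : DifferentiableAt ℝ τ y) (w : PhaseSpace n) :
    liouvillePullback (g ∘ τ) y w = liouvillePullback g (τ y) (fderiv ℝ τ y w) := by
  have h := mfderiv_comp y hg hτ.mdifferentiableAt
  rw [mfderiv_eq_fderiv] at h
  exact congrArg (fun A => liouvilleComp (g (τ y)) A w) h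

theorem liouvillePullback_extChartAt_symm (z : CotBundle n M) {y : PhaseSpace n}
    (hy : y ∈ (extChartAt (cotModel n) z).target) (w : PhaseSpace n) :
    liouvillePullback (extChartAt (cotModel n) z).symm y w = linearLiouville n y w :=
  liouvilleInChart_apply z hy w

/-- The differential of a chart of the cotangent bundle. -/
def chartDeriv (z₀ z : CotBundle n M) : PhaseSpace n →L[ℝ] PhaseSpace n :=
  mfderiv (cotModel n) 𝓘(ℝ, PhaseSpace n) (extChartAt (cotModel n) z₀) z

/-- The transition map between two charts of the cotangent bundle. -/
def transition (z z₀ : CotBundle n M) (y : PhaseSpace n) : PhaseSpace n :=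
  extChartAt (cotModel n) z₀ ((extChartAt (cotModel n) z).symm y)

/-- The domain of the transition map between two charts of the cotangent bundle. -/
def transitionSource (z z₀ : CotBundle n M) : Set (PhaseSpace n) :=
  (extChartAt (cotModel n) z).target ∩
    (extChartAt (cotModel n) z).symm ⁻¹' (extChartAt (cotModel n) z₀).source

theorem isOpen_transitionSource (z z₀ : CotBundle n M) : IsOpen (transitionSource z z₀) :=
  (continuousOn_extChartAt_symm z).isOpen_inter_preimage
    (isOpen_extChartAt_target z) (isOpen_extChartAt_source z₀)

theorem contDiffAt_transition {z z₀ : CotBundle n M} {y : PhaseSpace n}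
    (hy : y ∈ transitionSource z z₀) : ContDiffAt ℝ ∞ (transition z z₀) y := by
  have h : ContDiffOn ℝ ∞ (transition z z₀) (transitionSource z z₀) :=
    contDiffOn_ext_coord_change z₀ z
  exact h.contDiffAt ((isOpen_transitionSource z z₀).mem_nhds hy)

/-- Both sides are pullbacks of the one global Liouville form, by two inverse charts that differ by
the transition map. -/
theorem linearLiouville_transition {z z₀ : CotBundle n M} {y : PhaseSpace n}
    (hy : y ∈ transitionSource z z₀) (w : PhaseSpace n) :
    linearLiouville n y w =
      linearLiouville n (transition z z₀ y) (fderiv ℝ (transition z z₀) y w) := by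
  have hτ : transition z z₀ y ∈ (extChartAt (cotModel n) z₀).target :=
    (extChartAt (cotModel n) z₀).map_source hy.2
  have h1 : (extChartAt (cotModel n) z).symm =ᶠ[nhds y]
      (extChartAt (cotModel n) z₀).symm ∘ transition z z₀ := by
    filter_upwards [(isOpen_transitionSource z z₀).mem_nhds hy] with p hp
    exact ((extChartAt (cotModel n) z₀).left_inv hp.2).symm
  rw [← liouvillePullback_extChartAt_symm z hy.1, ← liouvillePullback_extChartAt_symm z₀ hτ,
    liouvillePullback_congr h1]
  exact liouvillePullback_comp (mdifferentiableAt_extChartAt_cot_symm hτ)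
    ((contDiffAt_transition hy).differentiableAt (by simp)) w

theorem mem_transitionSource {z z₀ : CotBundle n M}
    (h : z ∈ (extChartAt (cotModel n) z₀).source) :
    extChartAt (cotModel n) z z ∈ transitionSource z z₀ :=
  ⟨mem_extChartAt_target z, by rwa [Set.mem_preimage, extChartAt_to_inv]⟩

theorem fderiv_transition {z z₀ : CotBundle n M} (h : z ∈ (extChartAt (cotModel n) z₀).source) :
    fderiv ℝ (transition z z₀) (extChartAt (cotModel n) z z) = chartDeriv z₀ z := by
  have h3 : extChartAt (cotModel n) z₀ =ᶠ[nhds z] transition z z₀ ∘ extChartAt (cotModel n) z := by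
    filter_upwards [extChartAt_source_mem_nhds (I := cotModel n) z] with p hp
    exact congrArg _ ((extChartAt (cotModel n) z).left_inv hp).symm
  have hd := ((contDiffAt_transition (mem_transitionSource h)).differentiableAt
    (by simp)).mdifferentiableAt
  have h4 := mfderiv_comp z hd (mdifferentiableAt_extChartAt (mem_chart_source _ z))
  rw [mfderiv_eq_fderiv] at h4
  refine (h3.mfderiv_eq.trans (h4.trans ?_)).symm
  exact congrArg (ContinuousLinearMap.comp (fderiv ℝ (transition z z₀)
    (extChartAt (cotModel n) z z))) (mfderiv_extChartAt_cot_self z)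

/-- The standard symplectic form of any chart of the cotangent bundle represents the symplectic
form. -/
theorem linearSymplectic_chartDeriv {z₀ z : CotBundle n M}
    (h : z ∈ (extChartAt (cotModel n) z₀).source) (u v : PhaseSpace n) :
    linearSymplectic (chartDeriv z₀ z u) (chartDeriv z₀ z v) = symplecticForm z u v := by
  refine Eq.trans ?_ (symplecticForm_eq z u v).symm
  rw [← fderiv_transition h]
  refine (linearSymplectic_fderiv ((contDiffAt_transition (mem_transitionSource h)).of_le
    (by norm_cast)) ?_ u v).symm
  filter_upwards [(isOpen_transitionSource z z₀).mem_nhds (mem_transitionSource h)] with x hx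
  exact linearLiouville_transition hx

theorem chartDeriv_surjective {z₀ z : CotBundle n M}
    (h : z ∈ (extChartAt (cotModel n) z₀).source) : Function.Surjective (chartDeriv z₀ z) :=
  (isInvertible_mfderiv_extChartAt (I := cotModel n) h).bijective.2

end Charts

/-! ### Existence, smoothness and uniqueness of Hamiltonian fields -/

section HamiltonianField

variable {n : ℕ} {M : Type*} [TopologicalSpace M] [ChartedSpace (RSpace n) M]
  [IsManifold (𝓡 n) ∞ M]

theorem eq_of_symplecticForm_eq {z : CotBundle n M} {u v : TangentSpace (cotModel n) z}
    (h : ∀ w, symplecticForm z u w = symplecticForm z v w) : u = v :=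
  eq_of_linearSymplectic_eq (n := n) fun w =>
    (symplecticForm_eq z u w).symm.trans ((h w).trans (symplecticForm_eq z v w))

/-- The Hamiltonian vector field of a real function. -/
def hamiltonianVector (f : CotBundle n M → ℝ) (z : CotBundle n M) : TangentSpace (cotModel n) z :=
  linearSharp (n := n) (-(mfderiv (cotModel n) 𝓘(ℝ, ℝ) f z : PhaseSpace n →L[ℝ] ℝ))

theorem symplecticForm_hamiltonianVector (f : CotBundle n M → ℝ) (z : CotBundle n M)
    (v : TangentSpace (cotModel n) z) :
    symplecticForm z (hamiltonianVector f z) v = -mvfderiv (cotModel n) f z v := by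
  rw [symplecticForm_eq]
  exact linearSymplectic_linearSharp _ _

/-- Charts preserve the symplectic form and have surjective differential, so nondegeneracy
identifies the image of the field with the coordinate expression. -/
theorem chartDeriv_hamiltonianVector {f : CotBundle n M → ℝ}
    (hf : ContMDiff (cotModel n) 𝓘(ℝ, ℝ) ∞ f) {z₀ z : CotBundle n M}
    (h : z ∈ (extChartAt (cotModel n) z₀).source) :
    chartDeriv z₀ z (hamiltonianVector f z) =
      linearSharp (-fderiv ℝ (fun y => f ((extChartAt (cotModel n) z₀).symm y))
        (extChartAt (cotModel n) z₀ z)) := by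
  have hφz := (extChartAt (cotModel n) z₀).map_source h
  have h1 : f =ᶠ[nhds z] (fun y => f ((extChartAt (cotModel n) z₀).symm y)) ∘
      extChartAt (cotModel n) z₀ := by
    filter_upwards [(isOpen_extChartAt_source (I := cotModel n) z₀).mem_nhds h] with p hp
    exact congrArg f ((extChartAt (cotModel n) z₀).left_inv hp).symm
  have hd : MDifferentiableAt 𝓘(ℝ, PhaseSpace n) 𝓘(ℝ, ℝ)
      (fun y => f ((extChartAt (cotModel n) z₀).symm y)) (extChartAt (cotModel n) z₀ z) :=
    (hf.contMDiffAt.mdifferentiableAt (by simp)).comp _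
      (mdifferentiableAt_extChartAt_cot_symm hφz)
  have h2 := h1.mfderiv_eq.trans (mfderiv_comp z hd
    (mdifferentiableAt_extChartAt (by rwa [extChartAt_source] at h)))
  rw [mfderiv_eq_fderiv] at h2
  refine eq_of_linearSymplectic_eq fun w => ?_
  obtain ⟨v, rfl⟩ := chartDeriv_surjective h w
  rw [linearSymplectic_linearSharp]
  refine (linearSymplectic_chartDeriv h _ v).trans
    ((symplecticForm_hamiltonianVector f z v).trans ?_)
  exact congrArg (fun A : PhaseSpace n →L[ℝ] ℝ => -A v) h2

/-- In the fixed chart at `z₀` the field is `linearSharp` applied to the derivative of a smooth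
function. -/
theorem contMDiff_hamiltonianVector {f : CotBundle n M → ℝ}
    (hf : ContMDiff (cotModel n) 𝓘(ℝ, ℝ) ∞ f) :
    ContMDiff (cotModel n) (cotModel n).tangent ∞
      (fun z => (⟨z, hamiltonianVector f z⟩ : TangentBundle (cotModel n) (CotBundle n M))) := by
  intro z₀
  rw [contMDiffAt_section]
  have hφ : ContMDiffAt (cotModel n) 𝓘(ℝ, PhaseSpace n) ∞ (extChartAt (cotModel n) z₀) z₀ :=
    contMDiffAt_extChartAt
  have h1 : ContDiffAt ℝ ∞ (fun y => f ((extChartAt (cotModel n) z₀).symm y))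
      (extChartAt (cotModel n) z₀ z₀) := by
    have : ContMDiffAt 𝓘(ℝ, PhaseSpace n) 𝓘(ℝ, ℝ) ∞
        (fun y => f ((extChartAt (cotModel n) z₀).symm y)) (extChartAt (cotModel n) z₀ z₀) :=
      hf.contMDiffAt.comp _ ((contMDiffOn_extChartAt_symm z₀).contMDiffAt
        (extChartAt_target_mem_nhds z₀))
    exact this.contDiffAt
  have h2 : ContDiffAt ℝ ∞ (fun y => linearSharp
      (-fderiv ℝ (fun y => f ((extChartAt (cotModel n) z₀).symm y)) y))
      (extChartAt (cotModel n) z₀ z₀) :=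
    contDiff_linearSharp.contDiffAt.comp _ (h1.fderiv_right (m := ∞) (by simp)).neg
  refine (h2.contMDiffAt.comp z₀ hφ).congr_of_eventuallyEq ?_
  filter_upwards [extChartAt_source_mem_nhds (I := cotModel n) z₀] with z hz
  refine Eq.trans ?_ (chartDeriv_hamiltonianVector hf hz)
  rw [extChartAt_source] at hz
  have h3 := TangentBundle.continuousLinearMapAt_trivializationAt (I := cotModel n) hz
  refine Eq.trans ?_ (congrArg (fun A : PhaseSpace n →L[ℝ] PhaseSpace n =>
    A (hamiltonianVector f z)) h3)
  refine (Trivialization.continuousLinearMapAt_apply_of_mem ℝ _ ?_ _).symm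
  rwa [TangentBundle.trivializationAt_baseSet]

/-- The Hamiltonian field of a smooth complex function. -/
def hamiltonianField {F : CotBundle n M → ℂ} (hF : ContMDiff (cotModel n) 𝓘(ℝ, ℂ) ∞ F) :
    ComplexField n M where
  re := hamiltonianVector fun z => (F z).re
  im := hamiltonianVector fun z => (F z).im
  smooth_re := contMDiff_hamiltonianVector (Complex.reCLM.contDiff.contMDiff.comp hF)
  smooth_im := contMDiff_hamiltonianVector (Complex.imCLM.contDiff.contMDiff.comp hF)

theorem mvfderiv_clm_comp {F : CotBundle n M → ℂ} (hF : ContMDiff (cotModel n) 𝓘(ℝ, ℂ) ∞ F)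
    (L : ℂ →L[ℝ] ℝ) (z : CotBundle n M) (v : TangentSpace (cotModel n) z) :
    mvfderiv (cotModel n) (fun z => L (F z)) z v = L (mvfderiv (cotModel n) F z v) := by
  have h := mfderiv_comp (I'' := 𝓘(ℝ, ℝ)) z (L.differentiableAt (x := F z)).mdifferentiableAt
    (hF.contMDiffAt.mdifferentiableAt (x := z) (by simp))
  rw [mfderiv_eq_fderiv, L.fderiv] at h
  exact congrArg (fun A : PhaseSpace n →L[ℝ] ℝ => A v) h

/-- Since `ω₂` is real, the complex equation splits into two real ones. -/
theorem isHamiltonianField_iff {F : CotBundle n M → ℂ}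
    (hF : ContMDiff (cotModel n) 𝓘(ℝ, ℂ) ∞ F) {D : ComplexField n M} :
    IsHamiltonianField F D ↔ ∀ (z : CotBundle n M) (v : TangentSpace (cotModel n) z),
      symplecticForm z (D.re z) v = -mvfderiv (cotModel n) (fun z => (F z).re) z v ∧
      symplecticForm z (D.im z) v = -mvfderiv (cotModel n) (fun z => (F z).im) z v := by
  refine forall_congr' fun z => forall_congr' fun v => ?_
  have h1 := mvfderiv_clm_comp hF Complex.reCLM z v
  have h2 := mvfderiv_clm_comp hF Complex.imCLM z v
  simp only [Complex.reCLM_apply, Complex.imCLM_apply] at h1 h2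
  rw [h1, h2, Complex.ext_iff]
  simp [eq_neg_iff_add_eq_zero]

theorem isHamiltonianField_hamiltonianField {F : CotBundle n M → ℂ}
    (hF : ContMDiff (cotModel n) 𝓘(ℝ, ℂ) ∞ F) : IsHamiltonianField F (hamiltonianField hF) :=
  (isHamiltonianField_iff hF).2 fun z v =>
    ⟨symplecticForm_hamiltonianVector _ z v, symplecticForm_hamiltonianVector _ z v⟩

theorem IsHamiltonianField.unique {F : CotBundle n M → ℂ}
    (hF : ContMDiff (cotModel n) 𝓘(ℝ, ℂ) ∞ F) {D D' : ComplexField n M}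
    (h : IsHamiltonianField F D) (h' : IsHamiltonianField F D') : D = D' := by
  rw [isHamiltonianField_iff hF] at h h'
  exact ComplexField.ext
    (funext fun z => eq_of_symplecticForm_eq fun v => (h z v).1.trans (h' z v).1.symm)
    (funext fun z => eq_of_symplecticForm_eq fun v => (h z v).2.trans (h' z v).2.symm)

end HamiltonianField

/-! ### Functions with the same Hamiltonian field -/

section LocallyConstant

variable {n : ℕ} {M : Type*} [TopologicalSpace M] [ChartedSpace (RSpace n) M]
  [IsManifold (𝓡 n) ∞ M]

theorem isLocallyConstant_of_mvfderiv_eq_zero {F : CotBundle n M → ℂ}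
    (hF : ContMDiff (cotModel n) 𝓘(ℝ, ℂ) ∞ F) (h : ∀ z v, mvfderiv (cotModel n) F z v = 0) :
    IsLocallyConstant F := by
  refine (IsLocallyConstant.iff_eventually_eq F).2 fun z => ?_
  let φ := extChartAt (cotModel n) z
  let G : PhaseSpace n → ℂ := fun y => F (φ.symm y)
  have hG {y : PhaseSpace n} (hy : y ∈ φ.target) :
      HasFDerivAt (𝕜 := ℝ) G (0 : PhaseSpace n →L[ℝ] ℂ) y := by
    have h1 := mdifferentiableAt_extChartAt_cot_symm hy
    have h2 : MDifferentiableAt (cotModel n) 𝓘(ℝ, ℂ) F (φ.symm y) :=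
      hF.contMDiffAt.mdifferentiableAt (by simp)
    have h3 : MDifferentiableAt 𝓘(ℝ, PhaseSpace n) 𝓘(ℝ, ℂ) G y := h2.comp y h1
    have h4 := mfderiv_comp y h2 h1
    have h5 : fderiv ℝ G y = 0 := by
      refine ContinuousLinearMap.ext fun w => ?_
      rw [← mfderiv_eq_fderiv]
      exact (congrArg (fun A : PhaseSpace n →L[ℝ] ℂ => A w) h4).trans (h _ _)
    rw [← h5]
    exact h3.differentiableAt.hasFDerivAt
  obtain ⟨r, hr, hball⟩ := Metric.isOpen_iff.1 (isOpen_extChartAt_target (I := cotModel n) z) (φ z)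
    (mem_extChartAt_target z)
  have hconst : ∀ y ∈ Metric.ball (φ z) r, G y = G (φ z) := fun y hy =>
    Metric.isOpen_ball.is_const_of_fderiv_eq_zero (𝕜 := ℝ)
      (convex_ball (φ z) r).isPreconnected
      (fun p hp => (hG (hball hp)).differentiableAt.differentiableWithinAt)
      (fun p hp => (hG (hball hp)).fderiv) hy (Metric.mem_ball_self hr)
  filter_upwards [extChartAt_source_mem_nhds (I := cotModel n) z,
    (continuousAt_extChartAt (I := cotModel n) z).eventually (Metric.ball_mem_nhds (φ z) hr)]
    with p hp hp'
  have h6 : G (φ p) = F p := congrArg F (φ.left_inv hp)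
  have h7 : G (φ z) = F z := congrArg F (φ.left_inv (mem_extChartAt_source z))
  rw [← h6, ← h7]
  exact hconst _ hp'

/-- Each fibre is a connected vector space, and the zero section joins the fibres over the connected
base. -/
theorem exists_eq_const_of_mvfderiv_eq_zero [ConnectedSpace M] {F : CotBundle n M → ℂ}
    (hF : ContMDiff (cotModel n) 𝓘(ℝ, ℂ) ∞ F) (h : ∀ z v, mvfderiv (cotModel n) F z v = 0) :
    ∃ c : ℂ, ∀ z, F z = c := by
  have hloc := isLocallyConstant_of_mvfderiv_eq_zero hF h
  have h0 : Continuous (fun x : M => (⟨x, 0⟩ : CotBundle n M)) :=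
    (contMDiff_zeroSection (IB := 𝓡 n) (n := ∞) ℝ (F := RSpace n →L[ℝ] ℝ)
      (fun x : M => CotSpace n x)).continuous
  obtain ⟨x₀⟩ : Nonempty M := inferInstance
  refine ⟨F ⟨x₀, 0⟩, fun z => ?_⟩
  have h1 : F z = F ⟨z.1, 0⟩ := by
    have : PreconnectedSpace (CotSpace n z.1) := inferInstance
    exact (hloc.comp_continuous (FiberBundle.continuous_totalSpaceMk (RSpace n →L[ℝ] ℝ)
      (fun x : M => CotSpace n x) z.1)).apply_eq_of_preconnectedSpace z.2 0
  rw [h1]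
  exact (hloc.comp_continuous h0).apply_eq_of_preconnectedSpace z.1 x₀

theorem IsHamiltonianField.exists_eq_add_const [ConnectedSpace M] {F G : CotBundle n M → ℂ}
    (hF : ContMDiff (cotModel n) 𝓘(ℝ, ℂ) ∞ F) (hG : ContMDiff (cotModel n) 𝓘(ℝ, ℂ) ∞ G)
    {D : ComplexField n M} (h : IsHamiltonianField F D) (h' : IsHamiltonianField G D) :
    ∃ c : ℂ, ∀ z, F z = G z + c := by
  obtain ⟨c, hc⟩ := exists_eq_const_of_mvfderiv_eq_zero (F := fun z => F z - G z) (hF.sub hG)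
    fun z v => by
      have h1 := mvfderiv_fun_sub (hF.contMDiffAt.mdifferentiableAt (x := z) (by simp))
        (hG.contMDiffAt.mdifferentiableAt (x := z) (by simp))
      rw [h1]
      have h2 := (h z v).trans (h' z v).symm
      exact sub_eq_zero.2 (add_left_cancel h2)
  exact ⟨c, fun z => by rw [← hc z]; ring⟩

theorem IsHamiltonianField.of_eq_add_const {F G : CotBundle n M → ℂ}
    (hG : ContMDiff (cotModel n) 𝓘(ℝ, ℂ) ∞ G)
    {D : ComplexField n M} (h : IsHamiltonianField G D) {c : ℂ} (hc : ∀ z, F z = G z + c) :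
    IsHamiltonianField F D := fun z v => by
  have h1 := mvfderiv_fun_add (hG.contMDiffAt.mdifferentiableAt (x := z) (by simp))
    (mdifferentiableAt_const (c := c))
  rw [show F = fun z => G z + c from funext hc, h1, mvfderiv_const, add_zero]
  exact h z v

end LocallyConstant

/-! ### Additive constants and the final bijection -/

section Constants

variable {n : ℕ} {M : Type*} [TopologicalSpace M] [ChartedSpace (RSpace n) M]
  [IsManifold (𝓡 n) ∞ M]

variable (n M) in
/-- The tensor field of order `0` given by a constant. -/
def constTensor (c : ℂ) : SymTensorField n M :=
  DFinsupp.single 0 ⟨fun _ => MultilinearMap.constOfIsEmpty ℝ _ c,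
    fun _ _ _ => rfl, fun _ _ => contMDiff_const⟩

theorem hamiltonianOf_add_constTensor (Φ : SymTensorField n M) (c : ℂ) (z : CotBundle n M) :
    hamiltonianOf (Φ + constTensor n M c) z = hamiltonianOf Φ z + c := by
  rw [hamiltonianOf_add, constTensor, hamiltonianOf_single]
  rfl

theorem quantize_add_constTensor
    (nabla : CovariantDerivative (𝓡 n) (RSpace n) (TangentSpace (𝓡 n) : M → Type _))
    (hbar : ℝ) (Φ : SymTensorField n M) (c : ℂ) (f : M → ℂ) (x : M) :
    quantize nabla hbar (Φ + constTensor n M c) f x = quantize nabla hbar Φ f x + c * f x := by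
  rw [quantize_add, constTensor, quantize_single]
  simp [contract, symCovDiff, iterCovDiff]

theorem existsUnique_hamiltonianOf_eq {F : CotBundle n M → ℂ} (hF : IsPolyHamiltonian F) :
    ∃! Φ : SymTensorField n M, hamiltonianOf Φ = F := by
  obtain ⟨Φ, hΦ⟩ := exists_hamiltonianOf_eq hF
  exact ⟨Φ, hΦ, fun Ψ hΨ => hamiltonianOf_injective (hΨ.trans hΦ.symm)⟩

theorem existsUnique_isHamiltonianField {F : CotBundle n M → ℂ}
    (hF : ContMDiff (cotModel n) 𝓘(ℝ, ℂ) ∞ F) : ∃! D : ComplexField n M, IsHamiltonianField F D :=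
  ⟨hamiltonianField hF, isHamiltonianField_hamiltonianField hF,
    fun _ hD => hD.unique hF (isHamiltonianField_hamiltonianField hF)⟩

variable [T2Space M]
  {nabla : CovariantDerivative (𝓡 n) (RSpace n) (TangentSpace (𝓡 n) : M → Type _)}

theorem IsQuantized.unique (hsmooth : CovariantDerivative.ContMDiffCovariantDerivative nabla ∞)
    {hbar : ℝ} (hhbar : hbar ≠ 0) {Φ Ψ : SymTensorField n M} {P : Module.End ℂ (SmoothFun n M)}
    (h : IsQuantized nabla hbar Φ P) (h' : IsQuantized nabla hbar Ψ P) : Φ = Ψ := by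
  have : Φ + -Ψ = 0 := eq_zero_of_quantize_eq_zero hsmooth hhbar fun f x => by
    rw [quantize_add, quantize_neg, ← h f x, ← h' f x, add_neg_cancel]
  exact add_neg_eq_zero.1 this

/-- Both sides say `Φ = Ψ + constTensor n M c`: one by uniqueness of the dequantized tensor, the
other by injectivity of `hamiltonianOf`. -/
theorem eqUpToConst_iff (hsmooth : CovariantDerivative.ContMDiffCovariantDerivative nabla ∞)
    {hbar : ℝ} (hhbar : hbar ≠ 0) {Φ Ψ : SymTensorField n M} {P Q : DiffOp n M}
    (hP : IsQuantized nabla hbar Φ P.1) (hQ : IsQuantized nabla hbar Ψ Q.1) :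
    (eqUpToConst n M).r P Q ↔ ∃ c : ℂ, ∀ z, hamiltonianOf Φ z = hamiltonianOf Ψ z + c := by
  refine exists_congr fun c => ⟨fun h => ?_, fun h => ?_⟩
  · have : Φ = Ψ + constTensor n M c := hP.unique hsmooth hhbar fun f x => by
      rw [h, quantize_add_constTensor, hQ f x]
    rw [this]
    exact hamiltonianOf_add_constTensor Ψ c
  · have : Φ = Ψ + constTensor n M c := hamiltonianOf_injective (funext fun z => by
      rw [h, hamiltonianOf_add_constTensor])
    intro f x
    rw [hP f x, hQ f x, this, quantize_add_constTensor]

theorem existsUnique_isQuantized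
    (hsmooth : CovariantDerivative.ContMDiffCovariantDerivative nabla ∞) {hbar : ℝ}
    (hhbar : hbar ≠ 0) (P : DiffOp n M) : ∃! Φ : SymTensorField n M,
      IsQuantized nabla hbar Φ P.1 := by
  obtain ⟨r, hr⟩ := P.2
  obtain ⟨Φ, hΦ⟩ := exists_isQuantized hsmooth hhbar (r + 1) P.1 hr
  exact ⟨Φ, hΦ, fun Ψ hΨ => hΨ.unique hsmooth hhbar hΦ⟩

theorem exists_diffOp_isQuantized
    (hsmooth : CovariantDerivative.ContMDiffCovariantDerivative nabla ∞) (hbar : ℝ)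
    (Φ : SymTensorField n M) : ∃ P : DiffOp n M, IsQuantized nabla hbar Φ P.1 :=
  ⟨⟨quantizeOp hsmooth hbar Φ, exists_isDiffOpOfOrder_quantizeOp hsmooth hbar Φ⟩,
    fun _ _ => rfl⟩

theorem existsUnique_equiv_polyHamiltonianField [ConnectedSpace M]
    (hsmooth : CovariantDerivative.ContMDiffCovariantDerivative nabla ∞) {hbar : ℝ}
    (hhbar : hbar ≠ 0) :
    ∃! e : Quotient (eqUpToConst n M) ≃ PolyHamiltonianField n M,
      ∀ (P : DiffOp n M) (Φ : SymTensorField n M), IsQuantized nabla hbar Φ P.1 →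
        IsHamiltonianField (hamiltonianOf Φ) (e (Quotient.mk (eqUpToConst n M) P)).1 := by
  have hH (Φ : SymTensorField n M) := (isPolyHamiltonian_hamiltonianOf Φ).1
  choose sym hsym huniq using existsUnique_isQuantized (M := M) hsmooth hhbar
  let field (P : DiffOp n M) : PolyHamiltonianField n M :=
    ⟨hamiltonianField (hH (sym P)), hamiltonianOf (sym P), isPolyHamiltonian_hamiltonianOf _,
      isHamiltonianField_hamiltonianField _⟩
  have hfield (P : DiffOp n M) : IsHamiltonianField (hamiltonianOf (sym P)) (field P).1 :=
    isHamiltonianField_hamiltonianField (hH (sym P))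
  -- One implication makes the map well defined on the quotient; the other, where connectedness
  -- enters, makes it injective.
  have hiff (P Q : DiffOp n M) : (eqUpToConst n M).r P Q ↔ field P = field Q := by
    rw [eqUpToConst_iff hsmooth hhbar (hsym P) (hsym Q)]
    refine ⟨fun ⟨c, hc⟩ => Subtype.ext ?_, fun h => ?_⟩
    · exact (hfield P).unique (hH _) ((hfield Q).of_eq_add_const (hH _) hc)
    · exact (hfield P).exists_eq_add_const (hH _) (hH _) (h ▸ hfield Q)
  let g : Quotient (eqUpToConst n M) → PolyHamiltonianField n M :=
    Quotient.lift field fun P Q h => (hiff P Q).1 h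
  have hg : Function.Bijective g := by
    refine ⟨fun p q => ?_, fun D => ?_⟩
    · induction p using Quotient.inductionOn
      induction q using Quotient.inductionOn
      exact fun h => Quotient.sound ((hiff _ _).2 h)
    · obtain ⟨D, F, hF, hD⟩ := D
      obtain ⟨Φ, rfl⟩ := exists_hamiltonianOf_eq hF
      obtain ⟨P, hP⟩ := exists_diffOp_isQuantized hsmooth hbar Φ
      refine ⟨Quotient.mk _ P, Subtype.ext ?_⟩
      have := hfield P
      rw [← huniq P Φ hP] at this
      exact this.unique (hH Φ) hD
  refine ⟨Equiv.ofBijective g hg, fun P Φ hΦ => ?_, fun e he => Equiv.ext fun p => ?_⟩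
  · rw [huniq P Φ hΦ]
    exact hfield P
  -- Every class has a representative with a dequantized tensor, so uniqueness of the Hamiltonian
  -- field fixes all values of `e`.
  · induction p using Quotient.inductionOn with
    | h P => exact Subtype.ext ((he P _ (hsym P)).unique (hH _) (hfield P))

end Constants

end Dequantization

end

theorem mainTheorem4 (n : ℕ) (M : Type*) [TopologicalSpace M]
    [ChartedSpace (EuclideanSpace ℝ (Fin n)) M] [IsManifold (𝓡 n) ∞ M]
    [T2Space M] [SecondCountableTopology M] [ConnectedSpace M]
    (nabla : CovariantDerivative (𝓡 n) (EuclideanSpace ℝ (Fin n))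
      (TangentSpace (𝓡 n) : M → Type _))
    (hsmooth : CovariantDerivative.ContMDiffCovariantDerivative nabla ∞)
    (htorsion : nabla.torsion = 0)
    (hbar : ℝ) (hhbar : hbar ≠ 0) :
    -- every tensor field quantizes to a differential operator
    (∀ Φ : Dequantization.SymTensorField n M, ∃ P : Dequantization.DiffOp n M,
      Dequantization.IsQuantized nabla hbar Φ P.1) ∧
    -- every differential operator has exactly one dequantized tensor field
    (∀ P : Dequantization.DiffOp n M, ∃! Φ : Dequantization.SymTensorField n M,
      Dequantization.IsQuantized nabla hbar Φ P.1) ∧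
    -- tensor fields are the same as Hamiltonians polynomial along the fibres
    (∀ Φ : Dequantization.SymTensorField n M,
      Dequantization.IsPolyHamiltonian (Dequantization.hamiltonianOf Φ)) ∧
    (∀ F : Dequantization.CotBundle n M → ℂ, Dequantization.IsPolyHamiltonian F →
      ∃! Φ : Dequantization.SymTensorField n M, Dequantization.hamiltonianOf Φ = F) ∧
    -- every smooth function on the cotangent bundle has exactly one Hamiltonian field
    (∀ F : Dequantization.CotBundle n M → ℂ,
      ContMDiff (Dequantization.cotModel n) 𝓘(ℝ, ℂ) ∞ F →
      ∃! D : Dequantization.ComplexField n M, Dequantization.IsHamiltonianField F D) ∧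
    -- operator ↦ dequantized tensor ↦ function on `T*M` ↦ Hamiltonian field is a bijection
    -- from operators modulo additive constants onto the polynomial Hamiltonian fields
    ∃! e : Quotient (Dequantization.eqUpToConst n M) ≃
        Dequantization.PolyHamiltonianField n M,
      ∀ (P : Dequantization.DiffOp n M) (Φ : Dequantization.SymTensorField n M),
        Dequantization.IsQuantized nabla hbar Φ P.1 →
        Dequantization.IsHamiltonianField (Dequantization.hamiltonianOf Φ)
          (e (Quotient.mk (Dequantization.eqUpToConst n M) P)).1 :=
  ⟨Dequantization.exists_diffOp_isQuantized hsmooth hbar,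
    Dequantization.existsUnique_isQuantized hsmooth hhbar,
    Dequantization.isPolyHamiltonian_hamiltonianOf,
    fun _ => Dequantization.existsUnique_hamiltonianOf_eq,
    fun _ => Dequantization.existsUnique_isHamiltonianField,
    Dequantization.existsUnique_equiv_polyHamiltonianField hsmooth hhbar⟩
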